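/- Let $d=m+n$ with $m,n\ge 1$, and write $\mathbf x=(\mathbf x_1,\mathbf x_2)\in\mathbb R^m\times\mathbb R^n=\mathbb R^d$. Let $f:\mathbb R^d\to\mathbb R$ be twice differentiable and bounded below, with infimum $f^*$. Assume, for all arguments, $\|\nabla f(\mathbf x)-\nabla f(\mathbf y)\|\le L\|\mathbf x-\mathbf y\|$; $\|\nabla^2 f(\mathbf x)-\nabla^2 f(\mathbf y)\|\le\rho\|\mathbf x-\mathbf y\|$ with $\rho>0$; and that for $k=1,2$ the partial gradient $\nabla_k f$ is Lipschitz with constant $L_k$ in the block $\mathbf x_k$ (other block fixed) and with constant $\widetilde L_k$ in the other block ($\mathbf x_k$ fixed). Put $L_{\max}=\max\{L_1,L_2,\widetilde L_1,\widetilde L_2\}$ and assume $L_{\max}\le L$. For $\mathbf x^{(0)}\in\mathbb R^d$, $\epsilon,\delta,c>0$ let $\Delta_f=f(\mathbf x^{(0)})-f^*$, $\gamma=(L_{\max}\rho\epsilon)^{1/3}$, and $$\mathcal P=1+\frac{L\log(2d)}{L_{\max}},\quad \ell=\log\frac{\mathcal P^2 d L_{\max}^{5/3}\Delta_f}{c^5\rho^{1/3}\epsilon^{7/3}\delta},\quad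 \chi=6\max\{\ell,4\},\quad \nu=\frac{L_{\max}}{c},$$ $$r=\frac{c^3\epsilon}{\chi^3L_{\max}\mathcal P},\quad g_{\rm th}=\frac{c^2\epsilon}{\chi^3\mathcal P},\quad f_{\rm th}=\frac{c^5\epsilon^2}{L_{\max}\chi^6\mathcal P^2},\quad t_{\rm th}=\left\lceil\frac{L_{\max}\chi}{c^2\gamma}\right\rceil .$$ (If $\Delta_f=0$, then $\chi=24$ and $\max\{\ell,1\}=1$.) For a point $\mathbf x$ let $A(\mathbf x)=(\mathbf x_1^+,\mathbf x_2^+)$, where $\mathbf x_1^+=\arg\min_{\mathbf z}f(\mathbf z,\mathbf x_2)+\frac\nu2\|\mathbf z-\mathbf x_1\|^2$ and $\mathbf x_2^+=\arg\min_{\mathbf z}f(\mathbf x_1^+,\mathbf z)+\frac\nu2\|\mathbf z-\mathbf x_2\|^2$. The perturbed alternating proximal point method (PA-PP) performs the following for $t=0,1,2,\dots$. (1) If $\|A(\mathbf x^{(t)})-\mathbf x^{(t)}\|\le g_{\rm th}/\nu$ and either no perturbation has been made so far or $t-t_{\rm p}>t_{\rm th}$, set $\widetilde{\mathbf x}\leftarrow\mathbf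 x^{(t)}$, $t_{\rm p}\leftarrow t$ and $\mathbf x^{(t)}\leftarrow\widetilde{\mathbf x}+\xi^{(t)}$, where $\xi^{(0)},\xi^{(1)},\dots$ are independent and uniformly distributed on the ball of radius $r$ about $0$. (2) If a perturbation has been made, $t-t_{\rm p}=t_{\rm th}$ and $f(\mathbf x^{(t)})-f(\widetilde{\mathbf x})>-f_{\rm th}$, stop and return $\widetilde{\mathbf x}$. (3) Otherwise set $\mathbf x^{(t+1)}=A(\mathbf x^{(t)})$. Call $\mathbf x$ an $(\epsilon,\gamma)$-second-order stationary point if $\|\nabla f(\mathbf x)\|\le\epsilon$ and $\lambda_{\min}(\nabla^2f(\mathbf x))\ge-\gamma$. There are absolute constants $c_{\max}>0$ and $C>0$ such that for all such $m,n,f,L,L_k,\widetilde L_k,\rho,\mathbf x^{(0)}$, every $\delta\in(0,1]$, every $0<\epsilon\le L_{\max}^2/\rho$ and every $0<c\le c_{\max}$, the following holds with probability at least $1-\delta$. PA-PP stops and returns an $(\epsilon,(L_{\max}\rho\epsilon)^{1/3})$-second-order stationary point $\widetilde{\mathbf x}$. This point is the iterate with index $$t_{\rm p}\le\frac{C}{c^{7}}\,\frac{L_{\max}^{5/3}\mathcal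 P^2\Delta_f}{\rho^{1/3}\epsilon^{7/3}}\,\max\{\ell,1\}^7,$$ and the method stops at iteration $T=t_{\rm p}+t_{\rm th}$. Moreover, if $\mathbf x^{(0)}$ is not itself an $(\epsilon,(L_{\max}\rho\epsilon)^{1/3})$-second-order stationary point, then the total number $T$ of iterations satisfies $$T\le\frac{C}{c^{7}}\,\frac{L_{\max}^{5/3}\mathcal P^2\Delta_f}{\rho^{1/3}\epsilon^{7/3}}\,\log^7\!\left(\frac{\mathcal P^2 d L_{\max}^{5/3}\Delta_f}{c^5\rho^{1/3}\epsilon^{7/3}\delta}\right).$$ -/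

import Mathlib

open MeasureTheory ProbabilityTheory
open scoped Gradient

noncomputable section

namespace PAPP

/-- `ℝ^d` with `d = m + n`, split into a first block of dimension `m` and a second block of
dimension `n`, with the Euclidean norm. -/
abbrev Vec (m n : ℕ) : Type := EuclideanSpace ℝ (Fin m ⊕ Fin n)

variable {m n : ℕ}

/-- The first block `x₁` of `x`. -/
def blk₁ (x : Vec m n) : EuclideanSpace ℝ (Fin m) := WithLp.toLp 2 (fun i => x (Sum.inl i))

/-- The second block `x₂` of `x`. -/
def blk₂ (x : Vec m n) : EuclideanSpace ℝ (Fin n) := WithLp.toLp 2 (fun i => x (Sum.inr i))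

/-- The vector with blocks `(x₁, x₂)`. -/
def join (x₁ : EuclideanSpace ℝ (Fin m)) (x₂ : EuclideanSpace ℝ (Fin n)) : Vec m n :=
  WithLp.toLp 2 (Sum.elim (fun i => x₁ i) (fun j => x₂ j))

/-- The partial gradient with respect to the first block (the first block of the gradient). -/
def grad₁ (f : Vec m n → ℝ) (x : Vec m n) : EuclideanSpace ℝ (Fin m) := blk₁ (∇ f x)

/-- The partial gradient with respect to the second block. -/
def grad₂ (f : Vec m n → ℝ) (x : Vec m n) : EuclideanSpace ℝ (Fin n) := blk₂ (∇ f x)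

/-- The Hessian `∇² f(x)` as a linear operator. -/
def hess (f : Vec m n → ℝ) (x : Vec m n) : Vec m n →L[ℝ] Vec m n := fderiv ℝ (∇ f) x

/-- The smallest (real) eigenvalue of an operator on `ℝ^d`. -/
def lambdaMin (A : Vec m n →L[ℝ] Vec m n) : ℝ :=
  sInf {μ : ℝ | Module.End.HasEigenvalue (A : Vec m n →ₗ[ℝ] Vec m n) μ}

/-- `x` is an `(ε, γ)`-second-order stationary point of `f`. -/
def IsSS2 (f : Vec m n → ℝ) (ε γ : ℝ) (x : Vec m n) : Prop :=
  ‖∇ f x‖ ≤ ε ∧ -γ ≤ lambdaMin (hess f x)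

/-- `f` is twice differentiable, `L`-smooth, block-wise smooth with gradient Lipschitz constants
`L₁, L₂` (own block) and `K₁, K₂` (other block), and `ρ`-Hessian Lipschitz. -/
structure Assumption (f : Vec m n → ℝ) (L L₁ L₂ K₁ K₂ ρ : ℝ) : Prop where
  diff : Differentiable ℝ f
  diff_grad : Differentiable ℝ (∇ f)
  smooth : ∀ x y, ‖∇ f x - ∇ f y‖ ≤ L * ‖x - y‖
  block₁ : ∀ x₁ x₁' x₂, ‖grad₁ f (join x₁ x₂) - grad₁ f (join x₁' x₂)‖ ≤ L₁ * ‖x₁ - x₁'‖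
  block₂ : ∀ x₁ x₂ x₂', ‖grad₂ f (join x₁ x₂) - grad₂ f (join x₁ x₂')‖ ≤ L₂ * ‖x₂ - x₂'‖
  cross₁ : ∀ x₁ x₂ x₂', ‖grad₁ f (join x₁ x₂) - grad₁ f (join x₁ x₂')‖ ≤ K₁ * ‖x₂ - x₂'‖
  cross₂ : ∀ x₁ x₁' x₂, ‖grad₂ f (join x₁ x₂) - grad₂ f (join x₁' x₂)‖ ≤ K₂ * ‖x₁ - x₁'‖
  hessLip : ∀ x y, ‖hess f x - hess f y‖ ≤ ρ * ‖x - y‖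

/-- `L_max = max {L₁, L₂, K₁, K₂}`. -/
def Lmax (L₁ L₂ K₁ K₂ : ℝ) : ℝ := max (max L₁ L₂) (max K₁ K₂)

/-- `Δ_f = f(x⁰) - f*`, with `f*` the global minimum value (infimum) of `f`. -/
def gap (f : Vec m n → ℝ) (x₀ : Vec m n) : ℝ := f x₀ - ⨅ x, f x

/-! ### The parameters of the algorithm

`M` stands for `L_max`, `Δ` for `Δ_f`, `d` for the total dimension. -/

/-- `𝒫 = 1 + L log(2d) / L_max`. -/
def calP (d : ℕ) (L M : ℝ) : ℝ := 1 + L * Real.log (2 * (d : ℝ)) / M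

/-- `L_max^{5/3} 𝒫² Δ_f / (ρ^{1/3} ε^{7/3})`. -/
def rate (d : ℕ) (L M ρ ε Δ : ℝ) : ℝ :=
  M ^ (5 / 3 : ℝ) * calP d L M ^ 2 * Δ / (ρ ^ (1 / 3 : ℝ) * ε ^ (7 / 3 : ℝ))

/-- `log (𝒫² d L_max^{5/3} Δ_f / (c⁵ ρ^{1/3} ε^{7/3} δ))`. -/
def logTerm (d : ℕ) (L M ρ ε δ Δ c : ℝ) : ℝ :=
  Real.log (calP d L M ^ 2 * d * M ^ (5 / 3 : ℝ) * Δ /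
    (c ^ 5 * ρ ^ (1 / 3 : ℝ) * ε ^ (7 / 3 : ℝ) * δ))

/-- `χ = 6 max {log (...), 4}`. -/
def chi (d : ℕ) (L M ρ ε δ Δ c : ℝ) : ℝ := 6 * max (logTerm d L M ρ ε δ Δ c) 4

/-- The curvature tolerance `γ = (L_max ρ ε)^{1/3}`. -/
def gam (M ρ ε : ℝ) : ℝ := (M * ρ * ε) ^ (1 / 3 : ℝ)

/-- The proximal penalty `ν = L_max / c`. -/
def nu (M c : ℝ) : ℝ := M / c

/-- The perturbation radius `r = c³ ε / (χ³ L_max 𝒫)`. -/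
def radius (d : ℕ) (L M ρ ε δ Δ c : ℝ) : ℝ :=
  c ^ 3 * ε / (chi d L M ρ ε δ Δ c ^ 3 * M * calP d L M)

/-- `g_th = c² ε / (χ³ 𝒫)`. -/
def gth (d : ℕ) (L M ρ ε δ Δ c : ℝ) : ℝ :=
  c ^ 2 * ε / (chi d L M ρ ε δ Δ c ^ 3 * calP d L M)

/-- `f_th = c⁵ ε² / (L_max χ⁶ 𝒫²)`. -/
def fth (d : ℕ) (L M ρ ε δ Δ c : ℝ) : ℝ :=
  c ^ 5 * ε ^ 2 / (M * chi d L M ρ ε δ Δ c ^ 6 * calP d L M ^ 2)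

/-- `t_th = L_max χ / (c² (L_max ρ ε)^{1/3})`, rounded up to an integer. -/
def tth (d : ℕ) (L M ρ ε δ Δ c : ℝ) : ℕ :=
  ⌈M * chi d L M ρ ε δ Δ c / (c ^ 2 * gam M ρ ε)⌉₊

/-! ### The algorithm -/

/-- A global minimizer of `F` (an arbitrary point if there is none). -/
def argmin {α : Type*} [Nonempty α] (F : α → ℝ) : α :=
  Classical.epsilon (fun z => ∀ w, F z ≤ F w)

/-- First block update: `argmin_z f(z, x₂) + (ν/2) ‖z - x₁‖²`. -/
def prox₁ (f : Vec m n → ℝ) (ν : ℝ) (x : Vec m n) : EuclideanSpace ℝ (Fin m) :=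
  argmin (fun z => f (join z (blk₂ x)) + ν / 2 * ‖z - blk₁ x‖ ^ 2)

/-- Second block update, with the first block already updated:
`argmin_z f(x₁⁺, z) + (ν/2) ‖z - x₂‖²`. -/
def prox₂ (f : Vec m n → ℝ) (ν : ℝ) (x : Vec m n) : EuclideanSpace ℝ (Fin n) :=
  argmin (fun z => f (join (prox₁ f ν x) z) + ν / 2 * ‖z - blk₂ x‖ ^ 2)

/-- One full sweep of the alternating proximal point method. -/
def appStep (f : Vec m n → ℝ) (ν : ℝ) (x : Vec m n) : Vec m n :=
  join (prox₁ f ν x) (prox₂ f ν x)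

/-- State of the algorithm: either still running, with the current iterate and, if there has been
a perturbation, the time `t_p` of the last one and the iterate just before it; or stopped, having
returned the iterate `xp`, which was the iterate at the time `tp` of the last perturbation. -/
inductive State (m n : ℕ) : Type
  | running (x : Vec m n) (last : Option (ℕ × Vec m n)) : State m n
  | returned (tp : ℕ) (xp : Vec m n) : State m n

open Classical in
/-- Iteration `t` of the perturbed alternating proximal point method with penalty `ν`, thresholds
`g`, `φ`, `τ` and noise sequence `ξ`. -/
def iteration (f : Vec m n → ℝ) (ν g φ : ℝ) (τ : ℕ) (ξ : ℕ → Vec m n) (t : ℕ) :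
    State m n → State m n
  | .returned tp xp => .returned tp xp
  | .running x last =>
      -- perturb when the next step would be short and no perturbation is recent
      let perturb : Prop := ‖appStep f ν x - x‖ ≤ g / ν ∧ ∀ q ∈ last, q.1 + τ < t
      let last' : Option (ℕ × Vec m n) := if perturb then some (t, x) else last
      let x' : Vec m n := if perturb then x + ξ t else x
      match last' with
      | none => .running (appStep f ν x') none
      | some (tp, xp) =>
          if t = tp + τ ∧ f x' - f xp > -φ then .returned tp xp
          else .running (appStep f ν x') (some (tp, xp))

/-- The state before iteration `t`, started at `x₀` with no earlier perturbation. -/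
def run (f : Vec m n → ℝ) (ν g φ : ℝ) (τ : ℕ) (ξ : ℕ → Vec m n) (x₀ : Vec m n) : ℕ → State m n
  | 0 => .running x₀ none
  | t + 1 => iteration f ν g φ τ ξ t (run f ν g φ τ ξ x₀ t)

/-- The algorithm stops in iteration `T` (that is, after exactly `T` full sweeps) and returns
`xp`, the iterate with index `tp`. -/
def ReturnsAt (f : Vec m n → ℝ) (ν g φ : ℝ) (τ : ℕ) (ξ : ℕ → Vec m n) (x₀ : Vec m n)
    (T tp : ℕ) (xp : Vec m n) : Prop :=
  (∃ x last, run f ν g φ τ ξ x₀ T = .running x last) ∧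
    run f ν g φ τ ξ x₀ (T + 1) = .returned tp xp

end PAPP

end

/-! A sweep decreases `f` by at least `ν/2 * ‖step‖²`, and a short step forces a small gradient, so
the only danger is a perturbation at a point `z` where the Hessian `H` has a direction `e` with
curvature below `-γ`. A trajectory that does not decrease `f` enough afterwards stays close to `z`.
If two such trajectories start on a line parallel to `e`, their difference evolves by alternating
proximal sweeps for the quadratic form of `H`, up to a small error. Scaling the blocks of the
`t`-th difference by `s^(2t)` and `s^(2t+1)`, where `s² = 1 + γ/(2ν)`, makes the energy of this
recursion almost nonincreasing; it is negative at the start, so the difference grows like `s^(2t)`.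
As both trajectories stay near `z`, their starting points were exponentially close. Hence the set of
perturbations that fail is thin in the direction `e`: many disjoint translates of it fit into a
slightly larger ball, and its volume is small. A perturbation is independent of the iterate it is
applied to, and the decrease of `f` bounds the number of possible perturbation times, so a union
bound finishes the proof. -/

namespace PAPP

open scoped RealInnerProductSpace

noncomputable section

section Calculus

variable {E : Type*} [NormedAddCommGroup E] [InnerProductSpace ℝ E] [CompleteSpace E] {f : E → ℝ}

lemma hasDerivAt_comp_add_smul (hf : Differentiable ℝ f) (x h : E) (t : ℝ) :
    HasDerivAt (fun t : ℝ => f (x + t • h)) ⟪∇ f (x + t • h), h⟫ t := by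
  have hray : HasDerivAt (fun t : ℝ => x + t • h) h t := by
    simpa using ((hasDerivAt_id t).smul_const h).const_add x
  rw [inner_gradient_left]
  exact (hf (x + t • h)).hasFDerivAt.comp_hasDerivAt t hray

lemma apply_add_le_of_inner_gradient_le (hf : Differentiable ℝ f) (x h : E) {a b c : ℝ}
    (hb : ∀ t, 0 ≤ t → ⟪∇ f (x + t • h), h⟫ ≤ a + b * t + c * t ^ 2) :
    f (x + h) ≤ f x + a + b / 2 + c / 3 := by
  let p : ℝ → ℝ := fun t => a * t + b / 2 * t ^ 2 + c / 3 * t ^ 3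
  let g : ℝ → ℝ := fun t => f (x + t • h) - p t
  have hp (t : ℝ) : HasDerivAt p (a + b * t + c * t ^ 2) t := by
    refine ((((hasDerivAt_id t).const_mul a).add
      ((hasDerivAt_pow 2 t).const_mul (b / 2))).add
      ((hasDerivAt_pow 3 t).const_mul (c / 3))).congr_deriv ?_
    norm_num
    ring
  have hg (t : ℝ) : HasDerivAt g (⟪∇ f (x + t • h), h⟫ - (a + b * t + c * t ^ 2)) t :=
    (hasDerivAt_comp_add_smul hf x h t).sub (hp t)
  have hanti : AntitoneOn g (Set.Icc 0 1) := by
    refine antitoneOn_of_deriv_nonpos (convex_Icc 0 1)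
      (fun t _ => (hg t).continuousAt.continuousWithinAt)
      (fun t _ => (hg t).differentiableAt.differentiableWithinAt) fun t ht => ?_
    rw [interior_Icc] at ht
    rw [(hg t).deriv]
    linarith [hb t ht.1.le]
  have h01 := hanti (Set.left_mem_Icc.2 zero_le_one) (Set.right_mem_Icc.2 zero_le_one) zero_le_one
  simp only [g, p, one_smul, zero_smul, add_zero] at h01
  linarith

lemma apply_add_le_of_lipschitz_gradient (hf : Differentiable ℝ f) {K : ℝ}
    (hK : ∀ x y, ‖∇ f x - ∇ f y‖ ≤ K * ‖x - y‖) (x h : E) :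
    f (x + h) ≤ f x + ⟪∇ f x, h⟫ + K / 2 * ‖h‖ ^ 2 := by
  have hray (t : ℝ) (ht : 0 ≤ t) :
      ⟪∇ f (x + t • h), h⟫ ≤ ⟪∇ f x, h⟫ + K * ‖h‖ ^ 2 * t + 0 * t ^ 2 := by
    have hlip := hK (x + t • h) x
    have hcs := real_inner_le_norm (∇ f (x + t • h) - ∇ f x) h
    rw [add_sub_cancel_left, norm_smul, Real.norm_of_nonneg ht] at hlip
    rw [inner_sub_left] at hcs
    nlinarith [norm_nonneg h]
  linarith [apply_add_le_of_inner_gradient_le hf x h hray]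

lemma exists_le_sub_norm_gradient_sq (hf : Differentiable ℝ f) {K : ℝ} (hK0 : 0 < K)
    (hK : ∀ x y, ‖∇ f x - ∇ f y‖ ≤ K * ‖x - y‖) (x : E) :
    ∃ y, f y ≤ f x - ‖∇ f x‖ ^ 2 / (2 * K) := by
  refine ⟨x + (-K⁻¹) • ∇ f x,
    (apply_add_le_of_lipschitz_gradient hf hK x _).trans (le_of_eq ?_)⟩
  rw [inner_smul_right, real_inner_self_eq_norm_sq, norm_smul, mul_pow, Real.norm_eq_abs, sq_abs]
  field_simp
  ring

lemma isSymmetric_fderiv_gradient (hf : Differentiable ℝ f) (hf' : Differentiable ℝ (∇ f))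
    (x : E) : (fderiv ℝ (∇ f) x : E →ₗ[ℝ] E).IsSymmetric := by
  intro u v
  let J : E →L[ℝ] E →L[ℝ] ℝ :=
    LinearMap.mkContinuous₂ (innerₗ E) 1 fun x y => by
      simpa using norm_inner_le_norm (𝕜 := ℝ) x y
  have hJ (y : E) : HasFDerivAt f (J (∇ f y)) y := by
    have hJy : J (∇ f y) = fderiv ℝ f y := by
      ext w
      exact inner_gradient_left (𝕜 := ℝ) (f := f)
    exact hJy ▸ (hf y).hasFDerivAt
  have hJ' : HasFDerivAt (fun y => J (∇ f y)) (J.comp (fderiv ℝ (∇ f) x)) x :=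
    J.hasFDerivAt.comp x (hf' x).hasFDerivAt
  have hsymm : ⟪fderiv ℝ (∇ f) x u, v⟫ = ⟪fderiv ℝ (∇ f) x v, u⟫ :=
    second_derivative_symmetric hJ hJ' u v
  exact hsymm.trans (real_inner_comm _ _)

lemma norm_gradient_sub_fderiv_le (hf' : Differentiable ℝ (∇ f)) {ρ : ℝ} (hρ0 : 0 ≤ ρ)
    (hρ : ∀ x y, ‖fderiv ℝ (∇ f) x - fderiv ℝ (∇ f) y‖ ≤ ρ * ‖x - y‖) {x y z : E} {S : ℝ}
    (hx : ‖x - z‖ ≤ S) (hy : ‖y - z‖ ≤ S) :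
    ‖∇ f y - ∇ f x - fderiv ℝ (∇ f) z (y - x)‖ ≤ ρ * S * ‖y - x‖ := by
  refine (convex_closedBall z S).norm_image_sub_le_of_norm_fderiv_le' (𝕜 := ℝ)
    (fun w _ => hf' w) (fun w hw => ?_) (mem_closedBall_iff_norm.2 hx)
    (mem_closedBall_iff_norm.2 hy)
  exact (hρ w z).trans (mul_le_mul_of_nonneg_left (mem_closedBall_iff_norm.1 hw) hρ0)

lemma inner_gradient_add_smul_le_of_lipschitz_fderiv (hf' : Differentiable ℝ (∇ f)) {ρ : ℝ}
    (hρ0 : 0 ≤ ρ) (hρ : ∀ x y, ‖fderiv ℝ (∇ f) x - fderiv ℝ (∇ f) y‖ ≤ ρ * ‖x - y‖) (x h : E)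
    {t : ℝ} (ht : 0 ≤ t) :
    ⟪∇ f (x + t • h), h⟫ ≤ ⟪∇ f x, h⟫ + ⟪h, fderiv ℝ (∇ f) x h⟫ * t + ρ * ‖h‖ ^ 3 * t ^ 2 := by
  have htaylor := norm_gradient_sub_fderiv_le hf' hρ0 hρ (x := x) (y := x + t • h) (z := x)
    (S := t * ‖h‖) (by simpa using by positivity) (by simp [norm_smul, abs_of_nonneg ht])
  have hcs := real_inner_le_norm (∇ f (x + t • h) - ∇ f x - fderiv ℝ (∇ f) x (t • h)) h
  simp only [add_sub_cancel_left, norm_smul, Real.norm_of_nonneg ht] at htaylor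
  rw [inner_sub_left, inner_sub_left, map_smul, inner_smul_left, conj_trivial,
    real_inner_comm h (fderiv ℝ (∇ f) x h), ← map_smul] at hcs
  linarith [mul_le_mul_of_nonneg_right htaylor (norm_nonneg h)]

lemma exists_le_sub_of_inner_fderiv_gradient_le (hf : Differentiable ℝ f)
    (hf' : Differentiable ℝ (∇ f)) {ρ : ℝ} (hρ0 : 0 < ρ)
    (hρ : ∀ x y, ‖fderiv ℝ (∇ f) x - fderiv ℝ (∇ f) y‖ ≤ ρ * ‖x - y‖) {γ : ℝ} (hγ : 0 < γ)
    {x e : E} (he : ‖e‖ = 1) (hneg : ⟪e, fderiv ℝ (∇ f) x e⟫ ≤ -γ) :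
    ∃ y, f y ≤ f x - γ ^ 3 / (6 * ρ ^ 2) := by
  wlog hs : ⟪∇ f x, e⟫ ≤ 0 generalizing e
  · refine this (e := -e) (by simpa using he) (by simpa using hneg) ?_
    rw [inner_neg_right]
    linarith
  obtain ⟨α, hα, rfl⟩ : ∃ α, 0 < α ∧ γ = ρ * α := ⟨γ / ρ, div_pos hγ hρ0, by field_simp⟩
  refine ⟨x + α • e, ?_⟩
  have hcurv : ⟪α • e, fderiv ℝ (∇ f) x (α • e)⟫ ≤ -(ρ * α ^ 3) := by
    rw [map_smul, inner_smul_left, inner_smul_right, conj_trivial]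
    nlinarith [mul_le_mul_of_nonneg_left hneg (sq_nonneg α)]
  have hslope : ⟪∇ f x, α • e⟫ ≤ 0 := by
    rw [inner_smul_right]
    exact mul_nonpos_of_nonneg_of_nonpos hα.le hs
  have hcubic := apply_add_le_of_inner_gradient_le hf x (α • e) fun t ht =>
    inner_gradient_add_smul_le_of_lipschitz_fderiv hf' hρ0.le hρ x (α • e) ht
  rw [norm_smul, he, mul_one, Real.norm_of_nonneg hα.le] at hcubic
  have hval : (ρ * α) ^ 3 / (6 * ρ ^ 2) = ρ * α ^ 3 / 6 := by field_simp
  linarith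

end Calculus

section Blocks

variable {m n : ℕ}

@[simp] lemma blk₁_join (u : EuclideanSpace ℝ (Fin m)) (v : EuclideanSpace ℝ (Fin n)) :
    blk₁ (join u v) = u := rfl

@[simp] lemma blk₂_join (u : EuclideanSpace ℝ (Fin m)) (v : EuclideanSpace ℝ (Fin n)) :
    blk₂ (join u v) = v := rfl

@[simp] lemma join_blk (x : Vec m n) : join (blk₁ x) (blk₂ x) = x := by
  ext (i | i) <;> rfl

@[simp] lemma blk₁_add (x y : Vec m n) : blk₁ (x + y) = blk₁ x + blk₁ y := rfl
@[simp] lemma blk₂_add (x y : Vec m n) : blk₂ (x + y) = blk₂ x + blk₂ y := rfl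
@[simp] lemma blk₁_sub (x y : Vec m n) : blk₁ (x - y) = blk₁ x - blk₁ y := rfl
@[simp] lemma blk₂_sub (x y : Vec m n) : blk₂ (x - y) = blk₂ x - blk₂ y := rfl
@[simp] lemma blk₁_smul (a : ℝ) (x : Vec m n) : blk₁ (a • x) = a • blk₁ x := rfl
@[simp] lemma blk₂_smul (a : ℝ) (x : Vec m n) : blk₂ (a • x) = a • blk₂ x := rfl

lemma join_add (u u' : EuclideanSpace ℝ (Fin m)) (v v' : EuclideanSpace ℝ (Fin n)) :
    (join (u + u') (v + v') : Vec m n) = join u v + join u' v' := by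
  ext (i | i) <;> rfl

lemma join_sub (u u' : EuclideanSpace ℝ (Fin m)) (v v' : EuclideanSpace ℝ (Fin n)) :
    (join (u - u') (v - v') : Vec m n) = join u v - join u' v' := by
  ext (i | i) <;> rfl

lemma join_smul (a : ℝ) (u : EuclideanSpace ℝ (Fin m)) (v : EuclideanSpace ℝ (Fin n)) :
    (join (a • u) (a • v) : Vec m n) = a • join u v := by
  ext (i | i) <;> rfl

lemma inner_eq_blk (x y : Vec m n) : ⟪x, y⟫ = ⟪blk₁ x, blk₁ y⟫ + ⟪blk₂ x, blk₂ y⟫ := by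
  simp only [PiLp.inner_apply, Fintype.sum_sum_type]
  rfl

lemma norm_sq_eq_blk (x : Vec m n) : ‖x‖ ^ 2 = ‖blk₁ x‖ ^ 2 + ‖blk₂ x‖ ^ 2 := by
  simp only [← real_inner_self_eq_norm_sq, inner_eq_blk]

lemma norm_blk₁_le (x : Vec m n) : ‖blk₁ x‖ ≤ ‖x‖ := by
  refine le_of_sq_le_sq ?_ (norm_nonneg _)
  linarith [norm_sq_eq_blk x, sq_nonneg ‖blk₂ x‖]

lemma norm_blk₂_le (x : Vec m n) : ‖blk₂ x‖ ≤ ‖x‖ := by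
  refine le_of_sq_le_sq ?_ (norm_nonneg _)
  linarith [norm_sq_eq_blk x, sq_nonneg ‖blk₁ x‖]

lemma norm_le_blk (x : Vec m n) : ‖x‖ ≤ ‖blk₁ x‖ + ‖blk₂ x‖ := by
  refine le_of_sq_le_sq ?_ (by positivity)
  rw [norm_sq_eq_blk x]
  nlinarith [mul_nonneg (norm_nonneg (blk₁ x)) (norm_nonneg (blk₂ x))]

lemma continuous_join : Continuous fun p : EuclideanSpace ℝ (Fin m) × EuclideanSpace ℝ (Fin n) =>
    (join p.1 p.2 : Vec m n) := by
  refine (PiLp.continuous_toLp 2 _).comp (continuous_pi fun i => ?_)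
  rcases i with i | i
  · exact (PiLp.continuous_apply 2 _ i).comp continuous_fst
  · exact (PiLp.continuous_apply 2 _ i).comp continuous_snd

end Blocks

/-- The regularity used throughout: `f` is twice differentiable, one constant `M` bounds the
Lipschitz constants of both partial gradients in either block, and the Hessian is `ρ`-Lipschitz.
Unlike `Assumption`, it says nothing about the Lipschitz constant of the full gradient. -/
structure BlockSmooth {m n : ℕ} (f : Vec m n → ℝ) (M ρ : ℝ) : Prop where
  pos : 0 < M
  rho_pos : 0 < ρ
  diff : Differentiable ℝ f
  diff_grad : Differentiable ℝ (∇ f)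
  lip₁ : ∀ x y, ‖grad₁ f x - grad₁ f y‖ ≤ M * (‖blk₁ x - blk₁ y‖ + ‖blk₂ x - blk₂ y‖)
  lip₂ : ∀ x y, ‖grad₂ f x - grad₂ f y‖ ≤ M * (‖blk₁ x - blk₁ y‖ + ‖blk₂ x - blk₂ y‖)
  hessLip : ∀ x y, ‖hess f x - hess f y‖ ≤ ρ * ‖x - y‖

section BlockSmooth

variable {m n : ℕ} {f : Vec m n → ℝ} {L L₁ L₂ K₁ K₂ M ρ : ℝ}

lemma Assumption.lmax_pos (hm : 0 < m) (h : Assumption f L L₁ L₂ K₁ K₂ ρ)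
    (hne : Lmax L₁ L₂ K₁ K₂ ≠ 0) : 0 < Lmax L₁ L₂ K₁ K₂ := by
  have hL₁ : 0 ≤ L₁ := by
    simpa using (norm_nonneg _).trans (h.block₁ (EuclideanSpace.single ⟨0, hm⟩ 1) 0 0)
  have hle : L₁ ≤ Lmax L₁ L₂ K₁ K₂ := by simp [Lmax]
  exact (hL₁.trans hle).lt_of_ne hne.symm

lemma Assumption.blockSmooth (h : Assumption f L L₁ L₂ K₁ K₂ ρ) (hρ : 0 < ρ)
    (hpos : 0 < Lmax L₁ L₂ K₁ K₂) : BlockSmooth f (Lmax L₁ L₂ K₁ K₂) ρ where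
  pos := hpos
  rho_pos := hρ
  diff := h.diff
  diff_grad := h.diff_grad
  hessLip := h.hessLip
  lip₁ x y := by
    have hown := h.block₁ (blk₁ x) (blk₁ y) (blk₂ x)
    have hcross := h.cross₁ (blk₁ y) (blk₂ x) (blk₂ y)
    simp only [join_blk] at hown hcross
    calc ‖grad₁ f x - grad₁ f y‖
        ≤ L₁ * ‖blk₁ x - blk₁ y‖ + K₁ * ‖blk₂ x - blk₂ y‖ :=
          (norm_sub_le_norm_sub_add_norm_sub _ _ _).trans (add_le_add hown hcross)
      _ ≤ Lmax L₁ L₂ K₁ K₂ * (‖blk₁ x - blk₁ y‖ + ‖blk₂ x - blk₂ y‖) := by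
          rw [mul_add]
          gcongr <;> simp [Lmax]
  lip₂ x y := by
    have hown := h.block₂ (blk₁ y) (blk₂ x) (blk₂ y)
    have hcross := h.cross₂ (blk₁ x) (blk₁ y) (blk₂ x)
    simp only [join_blk] at hown hcross
    calc ‖grad₂ f x - grad₂ f y‖
        ≤ K₂ * ‖blk₁ x - blk₁ y‖ + L₂ * ‖blk₂ x - blk₂ y‖ :=
          (norm_sub_le_norm_sub_add_norm_sub _ _ _).trans (add_le_add hcross hown)
      _ ≤ Lmax L₁ L₂ K₁ K₂ * (‖blk₁ x - blk₁ y‖ + ‖blk₂ x - blk₂ y‖) := by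
          rw [mul_add]
          gcongr <;> simp [Lmax]

namespace BlockSmooth

lemma norm_grad_sub_le (hf : BlockSmooth f M ρ) (x y : Vec m n) :
    ‖∇ f x - ∇ f y‖ ≤ 2 * M * ‖x - y‖ := by
  have hM := hf.pos
  refine le_of_sq_le_sq ?_ (by positivity)
  have h₁ := pow_le_pow_left₀ (norm_nonneg _) (hf.lip₁ x y) 2
  have h₂ := pow_le_pow_left₀ (norm_nonneg _) (hf.lip₂ x y) 2
  rw [norm_sq_eq_blk, mul_pow, norm_sq_eq_blk (x - y), blk₁_sub, blk₂_sub, blk₁_sub, blk₂_sub]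
  simp only [grad₁, grad₂] at h₁ h₂
  nlinarith [sq_nonneg (M * (‖blk₁ x - blk₁ y‖ - ‖blk₂ x - blk₂ y‖))]

lemma norm_hess_le (hf : BlockSmooth f M ρ) (x : Vec m n) : ‖hess f x‖ ≤ 2 * M :=
  norm_fderiv_le_of_lip' ℝ (mul_nonneg zero_le_two hf.pos.le)
    (Filter.Eventually.of_forall fun y => hf.norm_grad_sub_le y x)

lemma norm_grad_sub_hess_le (hf : BlockSmooth f M ρ) {x y z : Vec m n} {S : ℝ}
    (hx : ‖x - z‖ ≤ S) (hy : ‖y - z‖ ≤ S) :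
    ‖∇ f y - ∇ f x - hess f z (y - x)‖ ≤ ρ * S * ‖y - x‖ :=
  norm_gradient_sub_fderiv_le hf.diff_grad hf.rho_pos.le hf.hessLip hx hy

lemma isSymmetric_hess (hf : BlockSmooth f M ρ) (x : Vec m n) :
    (hess f x : Vec m n →ₗ[ℝ] Vec m n).IsSymmetric :=
  isSymmetric_fderiv_gradient hf.diff hf.diff_grad x

end BlockSmooth

end BlockSmooth

section Prox

lemma argmin_prox_le {E : Type*} [NormedAddCommGroup E] [ProperSpace E] {F : E → ℝ}
    (hc : Continuous F) (hb : BddBelow (Set.range F)) {ν : ℝ} (hν : 0 < ν) (x w : E) :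
    F (argmin fun z => F z + ν / 2 * ‖z - x‖ ^ 2)
      + ν / 2 * ‖(argmin fun z => F z + ν / 2 * ‖z - x‖ ^ 2) - x‖ ^ 2
      ≤ F w + ν / 2 * ‖w - x‖ ^ 2 := by
  obtain ⟨B, hB⟩ := hb
  have hcoercive : Filter.Tendsto (fun z => F z + ν / 2 * ‖z - x‖ ^ 2) (Filter.cocompact E)
      Filter.atTop := by
    have hnorm : Filter.Tendsto (fun z : E => ‖z - x‖) (Filter.cocompact E) Filter.atTop := by
      simpa [dist_eq_norm] using tendsto_dist_right_cocompact_atTop x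
    have hsq := ((Filter.tendsto_pow_atTop two_ne_zero).comp hnorm).const_mul_atTop (half_pos hν)
    exact Filter.tendsto_atTop_mono (fun z => add_le_add_left (hB ⟨z, rfl⟩) _)
      (Filter.tendsto_atTop_add_const_left _ B hsq)
  have hmin : ∃ z, ∀ w, F z + ν / 2 * ‖z - x‖ ^ 2 ≤ F w + ν / 2 * ‖w - x‖ ^ 2 :=
    Continuous.exists_forall_le (by fun_prop) hcoercive
  exact Classical.epsilon_spec hmin w

lemma prox_stationary {E : Type*} [NormedAddCommGroup E] [InnerProductSpace ℝ E] {φ : E → ℝ}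
    {ν : ℝ} {x z g : E} (hd : ∀ h, HasDerivAt (fun t : ℝ => φ (z + t • h)) ⟪g, h⟫ 0)
    (hmin : ∀ w, φ z + ν / 2 * ‖z - x‖ ^ 2 ≤ φ w + ν / 2 * ‖w - x‖ ^ 2) :
    ν • (z - x) = -g := by
  have hfirst (h : E) : ⟪ν • (z - x) + g, h⟫ = 0 := by
    have hray : HasDerivAt (fun t : ℝ => z + t • h - x) h 0 := by
      simpa using (((hasDerivAt_id (0 : ℝ)).smul_const h).const_add z).sub_const x
    have hlocal : IsLocalMin ((fun t : ℝ => φ (z + t • h)) +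
        fun t : ℝ => ν / 2 * ‖z + t • h - x‖ ^ 2) 0 :=
      Filter.Eventually.of_forall fun t => by simpa using hmin (z + t • h)
    have hzero := hlocal.hasDerivAt_eq_zero ((hd h).add (hray.norm_sq.const_mul (ν / 2)))
    rw [zero_smul, add_zero] at hzero
    rw [inner_add_left, inner_smul_left, conj_trivial]
    linarith
  exact eq_neg_of_add_eq_zero_left (inner_self_eq_zero.1 (hfirst _))

lemma norm_sub_le_of_prox_eq {E : Type*} [SeminormedAddCommGroup E] [NormedSpace ℝ E]
    {M ν s : ℝ} {p p' q q' g g' : E} (hM : 0 < M) (hν : 2 * M ≤ ν) (hs : 0 ≤ s)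
    (hp : ν • (p - q) = -g) (hp' : ν • (p' - q') = -g')
    (hg : ‖g - g'‖ ≤ M * (‖p - p'‖ + s)) : ‖p - p'‖ ≤ 2 * ‖q - q'‖ + s := by
  have hν0 : 0 < ν := by linarith
  have hdiff : ν • ((p - p') - (q - q')) = -(g - g') :=
    calc ν • ((p - p') - (q - q')) = ν • (p - q) - ν • (p' - q') := by module
      _ = -(g - g') := by rw [hp, hp']; abel
  have hmove : ν * ‖(p - p') - (q - q')‖ ≤ ν * ((‖p - p'‖ + s) / 2) :=
    calc ν * ‖(p - p') - (q - q')‖ = ‖g - g'‖ := by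
          rw [← norm_neg (g - g'), ← hdiff, norm_smul, Real.norm_of_nonneg hν0.le]
      _ ≤ M * (‖p - p'‖ + s) := hg
      _ ≤ ν * ((‖p - p'‖ + s) / 2) := by nlinarith [norm_nonneg (p - p')]
  linarith [norm_sub_norm_le (p - p') (q - q'), le_of_mul_le_mul_left hmove hν0]

variable {m n : ℕ} {f : Vec m n → ℝ} {M ρ ν : ℝ}

lemma prox₁_le (hf : Continuous f) (hb : BddBelow (Set.range f)) (hν : 0 < ν) (x : Vec m n)
    (w : EuclideanSpace ℝ (Fin m)) :
    f (join (prox₁ f ν x) (blk₂ x)) + ν / 2 * ‖prox₁ f ν x - blk₁ x‖ ^ 2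
      ≤ f (join w (blk₂ x)) + ν / 2 * ‖w - blk₁ x‖ ^ 2 :=
  argmin_prox_le (F := fun z => f (join z (blk₂ x)))
    (hf.comp (continuous_join.comp (continuous_id.prodMk continuous_const)))
    (hb.mono (Set.range_comp_subset_range (fun z => join z (blk₂ x)) f)) hν (blk₁ x) w

lemma prox₂_le (hf : Continuous f) (hb : BddBelow (Set.range f)) (hν : 0 < ν) (x : Vec m n)
    (w : EuclideanSpace ℝ (Fin n)) :
    f (appStep f ν x) + ν / 2 * ‖prox₂ f ν x - blk₂ x‖ ^ 2
      ≤ f (join (prox₁ f ν x) w) + ν / 2 * ‖w - blk₂ x‖ ^ 2 :=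
  argmin_prox_le (F := fun z => f (join (prox₁ f ν x) z))
    (hf.comp (continuous_join.comp (continuous_const.prodMk continuous_id)))
    (hb.mono (Set.range_comp_subset_range (fun z => join (prox₁ f ν x) z) f)) hν (blk₂ x) w

@[simp] lemma blk₁_appStep (x : Vec m n) : blk₁ (appStep f ν x) = prox₁ f ν x := rfl

@[simp] lemma blk₂_appStep (x : Vec m n) : blk₂ (appStep f ν x) = prox₂ f ν x := rfl

lemma appStep_le (hf : Continuous f) (hb : BddBelow (Set.range f)) (hν : 0 < ν)
    (x : Vec m n) : f (appStep f ν x) + ν / 2 * ‖appStep f ν x - x‖ ^ 2 ≤ f x := by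
  have h₁ := prox₁_le hf hb hν x (blk₁ x)
  have h₂ := prox₂_le hf hb hν x (blk₂ x)
  rw [join_blk, sub_self, norm_zero] at h₁
  rw [sub_self, norm_zero] at h₂
  rw [norm_sq_eq_blk, blk₁_sub, blk₂_sub, blk₁_appStep, blk₂_appStep]
  linarith

lemma prox₁_eq (hf : Differentiable ℝ f) (hb : BddBelow (Set.range f)) (hν : 0 < ν)
    (x : Vec m n) :
    ν • (prox₁ f ν x - blk₁ x) = -grad₁ f (join (prox₁ f ν x) (blk₂ x)) := by
  refine prox_stationary (φ := fun z => f (join z (blk₂ x))) (fun h => ?_)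
    (prox₁_le hf.continuous hb hν x)
  have hray (t : ℝ) : join (prox₁ f ν x + t • h) (blk₂ x)
      = join (prox₁ f ν x) (blk₂ x) + t • join h 0 := by
    rw [← join_smul, ← join_add, smul_zero, add_zero]
  have hderiv := hasDerivAt_comp_add_smul hf (join (prox₁ f ν x) (blk₂ x)) (join h 0) 0
  rw [inner_eq_blk] at hderiv
  simpa [hray, grad₁] using hderiv

lemma prox₂_eq (hf : Differentiable ℝ f) (hb : BddBelow (Set.range f)) (hν : 0 < ν)
    (x : Vec m n) :
    ν • (prox₂ f ν x - blk₂ x) = -grad₂ f (appStep f ν x) := by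
  refine prox_stationary (φ := fun z => f (join (prox₁ f ν x) z)) (fun h => ?_)
    (prox₂_le hf.continuous hb hν x)
  have hray (t : ℝ) : join (prox₁ f ν x) (prox₂ f ν x + t • h)
      = appStep f ν x + t • join 0 h := by
    rw [appStep, ← join_smul, ← join_add, smul_zero, add_zero]
  have hderiv := hasDerivAt_comp_add_smul hf (appStep f ν x) (join 0 h) 0
  rw [inner_eq_blk] at hderiv
  simpa [hray, grad₂] using hderiv

namespace BlockSmooth

lemma norm_appStep_sub_le (hf : BlockSmooth f M ρ) (hb : BddBelow (Set.range f))
    (hν : 2 * M ≤ ν) (x y : Vec m n) : ‖appStep f ν x - appStep f ν y‖ ≤ 8 * ‖x - y‖ := by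
  have hν0 : 0 < ν := by linarith [hf.pos]
  have h₁ : ‖prox₁ f ν x - prox₁ f ν y‖ ≤ 2 * ‖blk₁ x - blk₁ y‖ + ‖blk₂ x - blk₂ y‖ :=
    norm_sub_le_of_prox_eq hf.pos hν (norm_nonneg _) (prox₁_eq hf.diff hb hν0 x)
      (prox₁_eq hf.diff hb hν0 y) (hf.lip₁ _ _)
  have h₂ : ‖prox₂ f ν x - prox₂ f ν y‖ ≤
      2 * ‖blk₂ x - blk₂ y‖ + ‖prox₁ f ν x - prox₁ f ν y‖ :=
    norm_sub_le_of_prox_eq hf.pos hν (norm_nonneg _) (prox₂_eq hf.diff hb hν0 x)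
      (prox₂_eq hf.diff hb hν0 y) ((hf.lip₂ _ _).trans_eq (by rw [add_comm]; rfl))
  have hstep := norm_le_blk (appStep f ν x - appStep f ν y)
  have hx₁ := norm_blk₁_le (x - y)
  have hx₂ := norm_blk₂_le (x - y)
  simp only [blk₁_sub, blk₂_sub, blk₁_appStep, blk₂_appStep] at hstep hx₁ hx₂
  linarith

lemma continuous_appStep (hf : BlockSmooth f M ρ) (hb : BddBelow (Set.range f))
    (hν : 2 * M ≤ ν) : Continuous (appStep f ν) := by
  refine (LipschitzWith.of_dist_le_mul (K := 8) fun x y => ?_).continuous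
  simpa [dist_eq_norm] using hf.norm_appStep_sub_le hb hν x y

lemma norm_grad_le (hf : BlockSmooth f M ρ) (hb : BddBelow (Set.range f))
    (hν : 2 * M ≤ ν) (x : Vec m n) : ‖∇ f x‖ ≤ 4 * ν * ‖appStep f ν x - x‖ := by
  have hM := hf.pos
  have hν0 : 0 < ν := by linarith
  have hstep₁ := norm_blk₁_le (appStep f ν x - x)
  have hstep₂ := norm_blk₂_le (appStep f ν x - x)
  simp only [blk₁_sub, blk₂_sub, blk₁_appStep, blk₂_appStep] at hstep₁ hstep₂
  have h₁ : ‖grad₁ f x‖ ≤ (ν + M) * ‖appStep f ν x - x‖ :=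
    calc ‖grad₁ f x‖
        ≤ ‖grad₁ f (join (prox₁ f ν x) (blk₂ x))‖
          + ‖grad₁ f x - grad₁ f (join (prox₁ f ν x) (blk₂ x))‖ := norm_le_norm_add_norm_sub' _ _
      _ ≤ ν * ‖prox₁ f ν x - blk₁ x‖ + M * ‖prox₁ f ν x - blk₁ x‖ := by
          have hlip := hf.lip₁ x (join (prox₁ f ν x) (blk₂ x))
          rw [blk₁_join, blk₂_join, sub_self, norm_zero, add_zero, norm_sub_rev (blk₁ x)] at hlip
          refine add_le_add (le_of_eq ?_) hlip
          rw [← norm_neg, ← prox₁_eq hf.diff hb hν0 x, norm_smul, Real.norm_of_nonneg hν0.le]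
      _ ≤ (ν + M) * ‖appStep f ν x - x‖ := by rw [← add_mul]; gcongr
  have h₂ : ‖grad₂ f x‖ ≤ (ν + 2 * M) * ‖appStep f ν x - x‖ :=
    calc ‖grad₂ f x‖
        ≤ ‖grad₂ f (appStep f ν x)‖ + ‖grad₂ f x - grad₂ f (appStep f ν x)‖ :=
          norm_le_norm_add_norm_sub' _ _
      _ ≤ ν * ‖prox₂ f ν x - blk₂ x‖
          + M * (‖prox₁ f ν x - blk₁ x‖ + ‖prox₂ f ν x - blk₂ x‖) := by
          have hlip := hf.lip₂ x (appStep f ν x)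
          rw [blk₁_appStep, blk₂_appStep, norm_sub_rev (blk₁ x), norm_sub_rev (blk₂ x)] at hlip
          refine add_le_add (le_of_eq ?_) hlip
          rw [← norm_neg, ← prox₂_eq hf.diff hb hν0 x, norm_smul, Real.norm_of_nonneg hν0.le]
      _ ≤ ν * ‖appStep f ν x - x‖ + M * (‖appStep f ν x - x‖ + ‖appStep f ν x - x‖) := by gcongr
      _ = (ν + 2 * M) * ‖appStep f ν x - x‖ := by ring
  calc ‖∇ f x‖ ≤ ‖grad₁ f x‖ + ‖grad₂ f x‖ := norm_le_blk _
    _ ≤ (2 * ν + 3 * M) * ‖appStep f ν x - x‖ := by linarith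
    _ ≤ 4 * ν * ‖appStep f ν x - x‖ := by gcongr; linarith

end BlockSmooth

end Prox

section Energy

lemma norm_sq_sub_le_mul_sum {E : Type*} [SeminormedAddCommGroup E] (v : ℕ → E) (t : ℕ) :
    ‖v t - v 0‖ ^ 2 ≤ t * ∑ k ∈ Finset.range t, ‖v (k + 1) - v k‖ ^ 2 :=
  calc ‖v t - v 0‖ ^ 2 ≤ (∑ k ∈ Finset.range t, ‖v (k + 1) - v k‖) ^ 2 := by
        rw [← Finset.sum_range_sub]
        gcongr
        exact norm_sum_le _ _
    _ ≤ t * ∑ k ∈ Finset.range t, ‖v (k + 1) - v k‖ ^ 2 := by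
        simpa using sq_sum_le_card_mul_sum_sq (s := Finset.range t)
          (f := fun k => ‖v (k + 1) - v k‖)

lemma norm_sq_le_of_increments {E : Type*} [SeminormedAddCommGroup E] {v : ℕ → E}
    {b γ ν R : ℝ} {t T : ℕ} (hν : 0 < ν) (hγ : 0 < γ) (h₀ : γ * ‖v 0‖ ^ 2 ≤ b)
    (hRγ : 2 / γ ≤ R) (hRT : 4 * T / ν ≤ R) (ht : t ≤ T) :
    ‖v t‖ ^ 2 ≤ R * (b + ν / 2 * ∑ k ∈ Finset.range T, ‖v (k + 1) - v k‖ ^ 2) := by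
  set S := ∑ k ∈ Finset.range T, ‖v (k + 1) - v k‖ ^ 2 with hS
  have : 0 ≤ S := Finset.sum_nonneg fun _ _ => sq_nonneg _
  have hstart : 2 * ‖v 0‖ ^ 2 ≤ R * b :=
    calc 2 * ‖v 0‖ ^ 2 = 2 / γ * (γ * ‖v 0‖ ^ 2) := by field_simp
      _ ≤ R * b := mul_le_mul hRγ h₀ (by positivity) (le_trans (by positivity) hRγ)
  have hmove : 2 * ‖v t - v 0‖ ^ 2 ≤ R * (ν / 2 * S) :=
    calc 2 * ‖v t - v 0‖ ^ 2 ≤ 2 * (t * ∑ k ∈ Finset.range t, ‖v (k + 1) - v k‖ ^ 2) := by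
          gcongr; exact norm_sq_sub_le_mul_sum v t
      _ ≤ 2 * (T * S) := by rw [hS]; gcongr
      _ = 4 * T / ν * (ν / 2 * S) := by field_simp; ring
      _ ≤ R * (ν / 2 * S) := by gcongr
  have hsplit : ‖v t‖ ^ 2 ≤ 2 * (‖v 0‖ ^ 2 + ‖v t - v 0‖ ^ 2) :=
    calc ‖v t‖ ^ 2 ≤ (‖v 0‖ + ‖v t - v 0‖) ^ 2 := by gcongr; exact norm_le_norm_add_norm_sub' _ _
      _ ≤ 2 * (‖v 0‖ ^ 2 + ‖v t - v 0‖ ^ 2) := add_sq_le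
  linarith

lemma half_le_of_increments {E : Type*} [SeminormedAddCommGroup E] {v : ℕ → E} {q : ℕ → ℝ}
    {θ γ ν R : ℝ} {T : ℕ} (hν : 0 < ν) (hθ : 0 ≤ θ) (hγ : 0 < γ)
    (hq : ∀ k < T, q k + ν / 2 * ‖v (k + 1) - v k‖ ^ 2
      ≤ q (k + 1) + θ / ν * (‖v k‖ ^ 2 + ‖v (k + 1)‖ ^ 2))
    (h₀ : γ * ‖v 0‖ ^ 2 ≤ q 0) (hRγ : 2 / γ ≤ R) (hRT : 4 * T / ν ≤ R)
    (hsmall : 4 * (T / ν) * θ * R ≤ 1) : q 0 / 2 ≤ q T := by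
  set B := q 0 + ν / 2 * ∑ k ∈ Finset.range T, ‖v (k + 1) - v k‖ ^ 2 with hB
  have hB0 : q 0 ≤ B := le_add_of_nonneg_right (by positivity)
  have hB1 : 0 ≤ B := le_trans (by positivity) (h₀.trans hB0)
  have hbound {t : ℕ} (ht : t ≤ T) : ‖v t‖ ^ 2 ≤ R * B :=
    norm_sq_le_of_increments hν hγ h₀ hRγ hRT ht
  have htotal : B ≤ q T + T * (θ / ν * (2 * (R * B))) := by
    have hsum : ∑ k ∈ Finset.range T, ν / 2 * ‖v (k + 1) - v k‖ ^ 2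
        ≤ ∑ k ∈ Finset.range T, (q (k + 1) - q k + θ / ν * (2 * (R * B))) := by
      refine Finset.sum_le_sum fun k hk => ?_
      have hk := Finset.mem_range.1 hk
      have herr : θ / ν * (‖v k‖ ^ 2 + ‖v (k + 1)‖ ^ 2) ≤ θ / ν * (2 * (R * B)) := by
        gcongr
        linarith [hbound hk.le, hbound hk]
      linarith [hq k hk]
    rw [← Finset.mul_sum, Finset.sum_add_distrib, Finset.sum_range_sub, Finset.sum_const,
      Finset.card_range, nsmul_eq_mul] at hsum
    linarith
  have herror : T * (θ / ν * (2 * (R * B))) ≤ B / 2 :=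
    calc T * (θ / ν * (2 * (R * B))) = 4 * (T / ν) * θ * R * (B / 2) := by ring
      _ ≤ 1 * (B / 2) := by gcongr
      _ = B / 2 := one_mul _
  linarith

variable {E : Type*} [NormedAddCommGroup E] [InnerProductSpace ℝ E]

/-- Half the quadratic form of the block operator `[[s² H + a, s H], [s H, s² H + a]]` at
`(u, y)`. When `u`, `y` are the two blocks of a vector, each padded with zeros, it is nonincreasing
along the alternating proximal point method for the quadratic function with Hessian `H`, rescaled
by the growth factor `s² = 1 + a / ν` per sweep. -/
def scaledEnergy (H : E →L[ℝ] E) (s a : ℝ) (u y : E) : ℝ :=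
  (s ^ 2 * (⟪u, H u⟫ + ⟪y, H y⟫) + a * (‖u‖ ^ 2 + ‖y‖ ^ 2)) / 2 + s * ⟪u, H y⟫

variable {H : E →L[ℝ] E} {K ν s a : ℝ} {u u' y y' ε ε' : E}

lemma scaledEnergy_comm (hH : (H : E →ₗ[ℝ] E).IsSymmetric) (u y : E) :
    scaledEnergy H s a u y = scaledEnergy H s a y u := by
  have hcross : ⟪u, H y⟫ = ⟪y, H u⟫ := by rw [real_inner_comm]; exact hH y u
  rw [scaledEnergy, scaledEnergy, hcross]
  ring

lemma abs_inner_map_le (hK : ‖H‖ ≤ K) (u y : E) : |⟪u, H y⟫| ≤ K * (‖u‖ * ‖y‖) :=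
  calc |⟪u, H y⟫| ≤ ‖u‖ * ‖H y‖ := abs_real_inner_le_norm _ _
    _ ≤ ‖u‖ * (K * ‖y‖) := by gcongr; exact H.le_of_opNorm_le hK y
    _ = K * (‖u‖ * ‖y‖) := by ring

lemma scaledEnergy_half_step (hH : (H : E →ₗ[ℝ] E).IsSymmetric) (hK : ‖H‖ ≤ K) (hν : 0 < ν)
    (hKν : 4 * K ≤ ν) (hs : s ^ 2 ≤ 2) (ha : 0 ≤ a)
    (hu : ν * ‖u' - u‖ ^ 2 = -⟪u' - u, s ^ 2 • H u' + a • u' + s • H y + ε⟫) :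
    scaledEnergy H s a u' y + ν / 2 * ‖u' - u‖ ^ 2 ≤ scaledEnergy H s a u y + ‖ε‖ ^ 2 / ν := by
  obtain ⟨p, rfl⟩ : ∃ p, u = u' - p := ⟨u' - u, (sub_sub_cancel _ _).symm⟩
  rw [sub_sub_cancel] at hu ⊢
  simp only [inner_add_right, real_inner_smul_right] at hu
  have hquad : ⟪u' - p, H (u' - p)⟫ = ⟪u', H u'⟫ - 2 * ⟪p, H u'⟫ + ⟪p, H p⟫ := by
    have hcross : ⟪u', H p⟫ = ⟪p, H u'⟫ := by rw [real_inner_comm]; exact hH p u'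
    rw [map_sub, inner_sub_left, inner_sub_right, inner_sub_right, hcross]
    ring
  have hnorm : ‖u' - p‖ ^ 2 = ‖u'‖ ^ 2 - 2 * ⟪p, u'⟫ + ‖p‖ ^ 2 := by
    rw [norm_sub_sq_real, real_inner_comm]
  have hcurv : -(s ^ 2 * ⟪p, H p⟫) ≤ ν / 2 * ‖p‖ ^ 2 := by
    have hform := neg_le_of_abs_le (abs_inner_map_le hK p p)
    have hK0 : 0 ≤ K := (norm_nonneg H).trans hK
    calc -(s ^ 2 * ⟪p, H p⟫) ≤ s ^ 2 * (K * (‖p‖ * ‖p‖)) := by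
          rw [← mul_neg]; gcongr; linarith
      _ ≤ 2 * (ν / 4 * (‖p‖ * ‖p‖)) := by gcongr; linarith
      _ = ν / 2 * ‖p‖ ^ 2 := by ring
  have herror : -⟪p, ε⟫ ≤ ν / 4 * ‖p‖ ^ 2 + ‖ε‖ ^ 2 / ν := by
    have hsq : 0 ≤ (ν / 2 * ‖p‖ - ‖ε‖) ^ 2 / ν := by positivity
    have hexpand : (ν / 2 * ‖p‖ - ‖ε‖) ^ 2 / ν
        = ν / 4 * ‖p‖ ^ 2 - ‖p‖ * ‖ε‖ + ‖ε‖ ^ 2 / ν := by field_simp; ring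
    linarith [neg_le_of_abs_le (abs_real_inner_le_norm p ε)]
  have hpad : 0 ≤ a * ‖p‖ ^ 2 := by positivity
  rw [scaledEnergy, scaledEnergy, hquad, hnorm, inner_sub_left]
  linarith

lemma scaledEnergy_step (hH : (H : E →ₗ[ℝ] E).IsSymmetric) (hK : ‖H‖ ≤ K) (hν : 0 < ν)
    (hKν : 4 * K ≤ ν) (hs : s ^ 2 ≤ 2) (ha : 0 ≤ a)
    (hu : ν * ‖u' - u‖ ^ 2 = -⟪u' - u, s ^ 2 • H u' + a • u' + s • H y + ε⟫)
    (hy : ν * ‖y' - y‖ ^ 2 = -⟪y' - y, s ^ 2 • H y' + a • y' + s • H u' + ε'⟫) :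
    scaledEnergy H s a u' y' + ν / 2 * (‖u' - u‖ ^ 2 + ‖y' - y‖ ^ 2)
      ≤ scaledEnergy H s a u y + (‖ε‖ ^ 2 + ‖ε'‖ ^ 2) / ν := by
  have h₁ := scaledEnergy_half_step hH hK hν hKν hs ha hu
  have h₂ := scaledEnergy_half_step hH hK hν hKν hs ha hy
  rw [scaledEnergy_comm hH y' u', scaledEnergy_comm hH y u'] at h₂
  rw [mul_add, add_div]
  linarith

lemma rescaled_half_step {k θ : ℝ} {p e : E} (hk : 0 < k) (hs0 : 0 ≤ s) (hs : s ^ 2 ≤ 2)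
    (hsa : ν * (s ^ 2 - 1) = a) (hθ : 0 ≤ θ)
    (h : ν * ⟪p, (k * s ^ 2) • u' - k • u⟫ = -⟪p, H ((k * s ^ 2) • u' + (k * s) • y) + e⟫)
    (he : ‖e‖ ≤ θ * (‖(k * s ^ 2) • u'‖ + ‖(k * s) • y‖)) :
    ν * ⟪p, u' - u⟫ = -⟪p, s ^ 2 • H u' + a • u' + s • H y + k⁻¹ • e⟫ ∧
      ‖k⁻¹ • e‖ ^ 2 ≤ 8 * θ ^ 2 * (‖u'‖ ^ 2 + ‖y‖ ^ 2) := by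
  constructor
  · refine mul_left_cancel₀ hk.ne' ?_
    simp only [map_add, map_smul, inner_add_right, inner_sub_right, real_inner_smul_right] at h ⊢
    have hcancel : k * (k⁻¹ * ⟪p, e⟫) = ⟪p, e⟫ := mul_inv_cancel_left₀ hk.ne' _
    rw [← hsa]
    linear_combination h + hcancel
  · have hbound : ‖k⁻¹ • e‖ ≤ θ * (2 * (‖u'‖ + ‖y‖)) := by
      rw [norm_smul, norm_inv, Real.norm_of_nonneg hk.le, inv_mul_le_iff₀ hk]
      refine he.trans ?_
      rw [norm_smul, norm_smul, Real.norm_of_nonneg (by positivity),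
        Real.norm_of_nonneg (by positivity)]
      calc θ * (k * s ^ 2 * ‖u'‖ + k * s * ‖y‖) = k * (θ * (s ^ 2 * ‖u'‖ + s * ‖y‖)) := by ring
        _ ≤ k * (θ * (2 * ‖u'‖ + 2 * ‖y‖)) := by gcongr; nlinarith
        _ = k * (θ * (2 * (‖u'‖ + ‖y‖))) := by ring
    calc ‖k⁻¹ • e‖ ^ 2 ≤ (θ * (2 * (‖u'‖ + ‖y‖))) ^ 2 := by gcongr
      _ = 4 * θ ^ 2 * (‖u'‖ + ‖y‖) ^ 2 := by ring
      _ ≤ 4 * θ ^ 2 * (2 * (‖u'‖ ^ 2 + ‖y‖ ^ 2)) := by gcongr; exact add_sq_le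
      _ = 8 * θ ^ 2 * (‖u'‖ ^ 2 + ‖y‖ ^ 2) := by ring

lemma scaledEnergy_rescaled_step (hH : (H : E →ₗ[ℝ] E).IsSymmetric) (hK : ‖H‖ ≤ K) (hν : 0 < ν)
    (hKν : 4 * K ≤ ν) (hs0 : 0 < s) (hs : s ^ 2 ≤ 2) (ha : 0 ≤ a) (hsa : ν * (s ^ 2 - 1) = a)
    {k θ : ℝ} (hk : 0 < k) (hθ : 0 ≤ θ)
    (hu : ν * ⟪u' - u, (k * s ^ 2) • u' - k • u⟫
      = -⟪u' - u, H ((k * s ^ 2) • u' + (k * s) • y) + ε⟫)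
    (hε : ‖ε‖ ≤ θ * (‖(k * s ^ 2) • u'‖ + ‖(k * s) • y‖))
    (hy : ν * ⟪y' - y, (k * s * s ^ 2) • y' - (k * s) • y⟫
      = -⟪y' - y, H ((k * s * s ^ 2) • y' + (k * s * s) • u') + ε'⟫)
    (hε' : ‖ε'‖ ≤ θ * (‖(k * s * s ^ 2) • y'‖ + ‖(k * s * s) • u'‖)) :
    scaledEnergy H s a u' y' + ν / 2 * (‖u' - u‖ ^ 2 + ‖y' - y‖ ^ 2) ≤ scaledEnergy H s a u y
      + 16 * θ ^ 2 / ν * ((‖u‖ ^ 2 + ‖y‖ ^ 2) + (‖u'‖ ^ 2 + ‖y'‖ ^ 2)) := by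
  obtain ⟨hu, hε⟩ := rescaled_half_step hk hs0.le hs hsa hθ hu hε
  obtain ⟨hy, hε'⟩ := rescaled_half_step (mul_pos hk hs0) hs0.le hs hsa hθ hy hε'
  rw [real_inner_self_eq_norm_sq] at hu hy
  refine (scaledEnergy_step hH hK hν hKν hs ha hu hy).trans ?_
  rw [div_mul_eq_mul_div]
  gcongr
  linarith [mul_nonneg (sq_nonneg θ) (sq_nonneg ‖u‖), mul_nonneg (sq_nonneg θ) (sq_nonneg ‖y‖),
    mul_nonneg (sq_nonneg θ) (sq_nonneg ‖y'‖)]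

lemma neg_scaledEnergy_le (hK : ‖H‖ ≤ K) (hs0 : 0 ≤ s) (hs : s ^ 2 ≤ 2) (ha : 0 ≤ a) (u y : E) :
    -scaledEnergy H s a u y ≤ 2 * K * (‖u‖ ^ 2 + ‖y‖ ^ 2) := by
  have hK0 : 0 ≤ K := (norm_nonneg H).trans hK
  have hdiag (w : E) : -(s ^ 2 * ⟪w, H w⟫) ≤ 2 * (K * (‖w‖ * ‖w‖)) := by
    rw [← mul_neg]
    refine mul_le_mul_of_nonneg hs ?_ (sq_nonneg s) (by positivity)
    linarith [neg_le_of_abs_le (abs_inner_map_le hK w w)]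
  have hcross : -(s * ⟪u, H y⟫) ≤ 2 * (K * (‖u‖ * ‖y‖)) := by
    rw [← mul_neg]
    refine mul_le_mul_of_nonneg (by nlinarith) ?_ hs0 (by positivity)
    linarith [neg_le_of_abs_le (abs_inner_map_le hK u y)]
  have hamgm : K * (2 * ‖u‖ * ‖y‖) ≤ K * (‖u‖ ^ 2 + ‖y‖ ^ 2) := by
    gcongr
    exact two_mul_le_add_sq _ _
  have hpad : 0 ≤ a * (‖u‖ ^ 2 + ‖y‖ ^ 2) := by positivity
  rw [scaledEnergy]
  linarith [hdiag u, hdiag y]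

lemma scaledEnergy_le_of_neg_curv (hH : (H : E →ₗ[ℝ] E).IsSymmetric) (hK : ‖H‖ ≤ K) {γ : ℝ}
    (hs : 1 ≤ s) (hsa : (s ^ 2 - 1) * (4 * K) ≤ a) (ha : 0 ≤ a) (haγ : a ≤ γ / 2)
    (hneg : ⟪u + y, H (u + y)⟫ ≤ -γ * (‖u‖ ^ 2 + ‖y‖ ^ 2)) :
    scaledEnergy H s a u (s⁻¹ • y) ≤ -(γ / 8 * (‖u‖ ^ 2 + ‖y‖ ^ 2)) := by
  have hs0 : s ≠ 0 := by positivity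
  have hexpand : ⟪u + y, H (u + y)⟫ = ⟪u, H u⟫ + ⟪y, H y⟫ + 2 * ⟪u, H y⟫ := by
    have hcross : ⟪y, H u⟫ = ⟪u, H y⟫ := by rw [real_inner_comm]; exact hH u y
    rw [map_add, inner_add_left, inner_add_right, inner_add_right, hcross]
    ring
  have henergy : scaledEnergy H s a u (s⁻¹ • y) =
      (⟪u + y, H (u + y)⟫ + (s ^ 2 - 1) * ⟪u, H u⟫ + a * (‖u‖ ^ 2 + (s⁻¹ * ‖y‖) ^ 2)) / 2 := by
    rw [scaledEnergy, hexpand, norm_smul, Real.norm_of_nonneg (by positivity), map_smul,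
      real_inner_smul_left, real_inner_smul_right, real_inner_smul_right]
    field_simp
    ring
  have hfirst : (s ^ 2 - 1) * ⟪u, H u⟫ ≤ a / 4 * ‖u‖ ^ 2 :=
    calc (s ^ 2 - 1) * ⟪u, H u⟫ ≤ (s ^ 2 - 1) * (K * (‖u‖ * ‖u‖)) := by
          gcongr
          · linarith [one_le_pow₀ hs (n := 2)]
          · exact le_of_abs_le (abs_inner_map_le hK u u)
      _ = (s ^ 2 - 1) * (4 * K) / 4 * ‖u‖ ^ 2 := by ring
      _ ≤ a / 4 * ‖u‖ ^ 2 := by gcongr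
  have hsecond : a * (s⁻¹ * ‖y‖) ^ 2 ≤ a * ‖y‖ ^ 2 := by
    gcongr
    exact mul_le_of_le_one_left (norm_nonneg y) (inv_le_one_of_one_le₀ hs)
  have hpad : a * (‖u‖ ^ 2 + ‖y‖ ^ 2) ≤ γ / 2 * (‖u‖ ^ 2 + ‖y‖ ^ 2) := by gcongr
  have hu0 : 0 ≤ a * ‖u‖ ^ 2 := by positivity
  have hy0 : 0 ≤ a * ‖y‖ ^ 2 := by positivity
  rw [henergy]
  linarith

end Energy

section Descent

variable {E : Type*} [SeminormedAddCommGroup E] {f : E → ℝ} {A : E → E} {ν : ℝ}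

lemma antitone_iterate_of_descent (hν : 0 ≤ ν) (hA : ∀ x, f (A x) + ν / 2 * ‖A x - x‖ ^ 2 ≤ f x)
    (x : E) : Antitone fun t => f (A^[t] x) := by
  refine antitone_nat_of_succ_le fun t => ?_
  rw [Function.iterate_succ_apply']
  exact (le_add_of_nonneg_right (by positivity)).trans (hA _)

lemma norm_iterate_sub_sq_le_of_descent (hν : 0 ≤ ν)
    (hA : ∀ x, f (A x) + ν / 2 * ‖A x - x‖ ^ 2 ≤ f x) (x : E) (t : ℕ) :
    ν / 2 * ‖A^[t] x - x‖ ^ 2 ≤ t * (f x - f (A^[t] x)) := by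
  have hdecrease : ν / 2 * ∑ k ∈ Finset.range t, ‖A^[k + 1] x - A^[k] x‖ ^ 2
      ≤ f x - f (A^[t] x) := by
    have htelescope := Finset.sum_range_sub' (fun k => f (A^[k] x)) t
    rw [Function.iterate_zero_apply] at htelescope
    rw [Finset.mul_sum, ← htelescope]
    refine Finset.sum_le_sum fun k _ => ?_
    rw [Function.iterate_succ_apply']
    linarith [hA (A^[k] x)]
  calc ν / 2 * ‖A^[t] x - x‖ ^ 2
      ≤ ν / 2 * (t * ∑ k ∈ Finset.range t, ‖A^[k + 1] x - A^[k] x‖ ^ 2) := by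
        gcongr; exact norm_sq_sub_le_mul_sum (fun k => A^[k] x) t
    _ = t * (ν / 2 * ∑ k ∈ Finset.range t, ‖A^[k + 1] x - A^[k] x‖ ^ 2) := by ring
    _ ≤ t * (f x - f (A^[t] x)) := by gcongr

end Descent

section Escape

variable {m n : ℕ}

/-- The orthogonal projection onto the first block. -/
def proj₁ : Vec m n →ₗ[ℝ] Vec m n where
  toFun x := join (blk₁ x) 0
  map_add' x y := by rw [blk₁_add, ← join_add, add_zero]
  map_smul' a x := by rw [blk₁_smul, RingHom.id_apply, ← join_smul, smul_zero]

/-- The orthogonal projection onto the second block. -/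
def proj₂ : Vec m n →ₗ[ℝ] Vec m n where
  toFun x := join 0 (blk₂ x)
  map_add' x y := by rw [blk₂_add, ← join_add, add_zero]
  map_smul' a x := by rw [blk₂_smul, RingHom.id_apply, ← join_smul, smul_zero]

lemma proj₁_add_proj₂ (x : Vec m n) : proj₁ x + proj₂ x = x :=
  calc proj₁ x + proj₂ x = join (blk₁ x + 0) (0 + blk₂ x) := (join_add _ _ _ _).symm
    _ = x := by rw [add_zero, zero_add, join_blk]

lemma inner_proj₁ (p x : Vec m n) : ⟪proj₁ p, x⟫ = ⟪blk₁ p, blk₁ x⟫ := by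
  simp [inner_eq_blk, proj₁]

lemma inner_proj₂ (p x : Vec m n) : ⟪proj₂ p, x⟫ = ⟪blk₂ p, blk₂ x⟫ := by
  simp [inner_eq_blk, proj₂]

lemma norm_sq_eq_proj (x : Vec m n) : ‖x‖ ^ 2 = ‖proj₁ x‖ ^ 2 + ‖proj₂ x‖ ^ 2 := by
  rw [norm_sq_eq_blk, norm_sq_eq_blk (proj₁ x), norm_sq_eq_blk (proj₂ x)]
  simp [proj₁, proj₂]

/-- The difference `w` of two trajectories after `t` sweeps, with the expected growth removed:
block one is updated first, so it has grown by `s ^ (2 * t)` when block two has grown by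
`s ^ (2 * t + 1)`. -/
def rescale (s : ℝ) (t : ℕ) (w : Vec m n) : Vec m n :=
  join ((s ^ (2 * t))⁻¹ • blk₁ w) ((s ^ (2 * t + 1))⁻¹ • blk₂ w)

lemma proj₁_rescale {s : ℝ} (hs : s ≠ 0) (t : ℕ) (w : Vec m n) :
    proj₁ w = s ^ (2 * t) • proj₁ (rescale s t w) := by
  change join (blk₁ w) 0 = s ^ (2 * t) • join ((s ^ (2 * t))⁻¹ • blk₁ w) 0
  rw [← join_smul, smul_zero, smul_inv_smul₀ (pow_ne_zero _ hs)]

lemma proj₂_rescale {s : ℝ} (hs : s ≠ 0) (t : ℕ) (w : Vec m n) :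
    proj₂ w = s ^ (2 * t + 1) • proj₂ (rescale s t w) := by
  change join 0 (blk₂ w) = s ^ (2 * t + 1) • join 0 ((s ^ (2 * t + 1))⁻¹ • blk₂ w)
  rw [← join_smul, smul_zero, smul_inv_smul₀ (pow_ne_zero _ hs)]

lemma pow_mul_norm_rescale_sq_le {s : ℝ} (hs : 1 ≤ s) (t : ℕ) (w : Vec m n) :
    s ^ (4 * t) * ‖rescale s t w‖ ^ 2 ≤ ‖w‖ ^ 2 := by
  have hs0 : s ≠ 0 := by positivity
  have hpow : s ^ (4 * t) ≤ (s ^ (2 * t + 1)) ^ 2 := by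
    rw [← pow_mul]
    exact pow_le_pow_right₀ hs (by omega)
  rw [norm_sq_eq_proj w, proj₁_rescale hs0 t, proj₂_rescale hs0 t, norm_sq_eq_proj (rescale s t w),
    norm_smul, norm_smul, mul_pow, mul_pow, Real.norm_eq_abs, Real.norm_eq_abs, sq_abs, sq_abs,
    mul_add]
  gcongr
  exact (by ring : s ^ (4 * t) = (s ^ (2 * t)) ^ 2).le

variable {f : Vec m n → ℝ} {M ρ ν S γ : ℝ} {x y z e : Vec m n}

lemma norm_join_prox₁_sub_le (hx : ‖x - z‖ ≤ S) (hx' : ‖appStep f ν x - z‖ ≤ S) :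
    ‖join (prox₁ f ν x) (blk₂ x) - z‖ ≤ 2 * S := by
  have hsplit := norm_le_blk (join (prox₁ f ν x) (blk₂ x) - z)
  have h₁ := norm_blk₁_le (appStep f ν x - z)
  have h₂ := norm_blk₂_le (x - z)
  simp only [blk₁_sub, blk₂_sub, blk₁_join, blk₂_join, blk₁_appStep] at hsplit h₁ h₂
  linarith

namespace BlockSmooth

lemma inner_proj₁_appStep_sub (hf : BlockSmooth f M ρ) (hb : BddBelow (Set.range f)) (hν : 0 < ν)
    (hx : ‖x - z‖ ≤ S) (hy : ‖y - z‖ ≤ S) (hx' : ‖appStep f ν x - z‖ ≤ S)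
    (hy' : ‖appStep f ν y - z‖ ≤ S) :
    ∃ ε, (∀ p, ν * ⟪proj₁ p, proj₁ (appStep f ν y - appStep f ν x) - proj₁ (y - x)⟫
        = -⟪proj₁ p, hess f z (proj₁ (appStep f ν y - appStep f ν x) + proj₂ (y - x)) + ε⟫) ∧
      ‖ε‖ ≤ 2 * ρ * S * (‖proj₁ (appStep f ν y - appStep f ν x)‖ + ‖proj₂ (y - x)‖) := by
  set x₁ := join (prox₁ f ν x) (blk₂ x) with hx₁
  set y₁ := join (prox₁ f ν y) (blk₂ y) with hy₁
  have hdiff : y₁ - x₁ = proj₁ (appStep f ν y - appStep f ν x) + proj₂ (y - x) := by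
    rw [hx₁, hy₁, ← join_sub]
    simp [proj₁, proj₂, ← join_add]
  have herr := hf.norm_grad_sub_hess_le (norm_join_prox₁_sub_le hx hx')
    (norm_join_prox₁_sub_le hy hy')
  have hρS : 0 ≤ 2 * ρ * S := by
    have := hf.rho_pos
    have := (norm_nonneg _).trans hx
    positivity
  refine ⟨∇ f y₁ - ∇ f x₁ - hess f z (y₁ - x₁), fun p => ?_, ?_⟩
  · have hblk : ν • (blk₁ (appStep f ν y - appStep f ν x) - blk₁ (y - x))
        = -(grad₁ f y₁ - grad₁ f x₁) := by
      have hprox_x := prox₁_eq hf.diff hb hν x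
      have hprox_y := prox₁_eq hf.diff hb hν y
      rw [blk₁_sub, blk₁_sub, blk₁_appStep, blk₁_appStep]
      linear_combination (norm := module) hprox_y - hprox_x
    rw [← hdiff, add_sub_cancel, ← map_sub, inner_proj₁, inner_proj₁, ← real_inner_smul_right,
      ← inner_neg_right]
    exact congrArg (fun v => ⟪blk₁ p, v⟫) hblk
  · rw [hdiff] at herr ⊢
    refine herr.trans ?_
    rw [mul_left_comm, ← mul_assoc]
    gcongr
    exact norm_add_le _ _

lemma inner_proj₂_appStep_sub (hf : BlockSmooth f M ρ) (hb : BddBelow (Set.range f)) (hν : 0 < ν)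
    (hx' : ‖appStep f ν x - z‖ ≤ S) (hy' : ‖appStep f ν y - z‖ ≤ S) :
    ∃ ε, (∀ p, ν * ⟪proj₂ p, proj₂ (appStep f ν y - appStep f ν x) - proj₂ (y - x)⟫
        = -⟪proj₂ p, hess f z (proj₂ (appStep f ν y - appStep f ν x)
          + proj₁ (appStep f ν y - appStep f ν x)) + ε⟫) ∧
      ‖ε‖ ≤ 2 * ρ * S * (‖proj₂ (appStep f ν y - appStep f ν x)‖
        + ‖proj₁ (appStep f ν y - appStep f ν x)‖) := by
  set x' := appStep f ν x with hx_def
  set y' := appStep f ν y with hy_def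
  have hdiff : proj₂ (y' - x') + proj₁ (y' - x') = y' - x' := by
    rw [add_comm, proj₁_add_proj₂]
  have hρ := hf.rho_pos
  have hS : 0 ≤ S := (norm_nonneg _).trans hx'
  refine ⟨∇ f y' - ∇ f x' - hess f z (y' - x'), fun p => ?_, ?_⟩
  · have hblk : ν • (blk₂ (y' - x') - blk₂ (y - x)) = -(grad₂ f y' - grad₂ f x') := by
      have hprox_x := prox₂_eq hf.diff hb hν x
      have hprox_y := prox₂_eq hf.diff hb hν y
      rw [blk₂_sub, blk₂_sub, hx_def, hy_def, blk₂_appStep, blk₂_appStep]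
      linear_combination (norm := module) hprox_y - hprox_x
    rw [hdiff, add_sub_cancel, ← map_sub, inner_proj₂, inner_proj₂, ← real_inner_smul_right,
      ← inner_neg_right]
    exact congrArg (fun v => ⟪blk₂ p, v⟫) hblk
  · calc ‖∇ f y' - ∇ f x' - hess f z (y' - x')‖ ≤ ρ * S * ‖y' - x'‖ :=
          hf.norm_grad_sub_hess_le hx' hy'
      _ ≤ 2 * ρ * S * ‖y' - x'‖ := by gcongr; linarith
      _ ≤ 2 * ρ * S * (‖proj₂ (y' - x')‖ + ‖proj₁ (y' - x')‖) := by
          nth_rw 1 [← hdiff]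
          gcongr
          exact norm_add_le _ _

lemma scaledEnergy_rescale_step (hf : BlockSmooth f M ρ) (hb : BddBelow (Set.range f))
    (hν : 8 * M ≤ ν) {s a : ℝ} (hs0 : 0 < s) (hs : s ^ 2 ≤ 2) (ha : 0 ≤ a)
    (hsa : ν * (s ^ 2 - 1) = a) (hx : ‖x - z‖ ≤ S) (hy : ‖y - z‖ ≤ S)
    (hx' : ‖appStep f ν x - z‖ ≤ S) (hy' : ‖appStep f ν y - z‖ ≤ S) (t : ℕ) {v v' : Vec m n}
    (hv : v = rescale s t (y - x)) (hv' : v' = rescale s (t + 1) (appStep f ν y - appStep f ν x)) :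
    scaledEnergy (hess f z) s a (proj₁ v') (proj₂ v') + ν / 2 * ‖v' - v‖ ^ 2
      ≤ scaledEnergy (hess f z) s a (proj₁ v) (proj₂ v)
        + 64 * (ρ * S) ^ 2 / ν * (‖v‖ ^ 2 + ‖v'‖ ^ 2) := by
  have hM := hf.pos
  have hρ := hf.rho_pos
  have hS : 0 ≤ S := (norm_nonneg _).trans hx
  have hν0 : 0 < ν := by linarith
  obtain ⟨ε₁, h₁, hε₁⟩ := hf.inner_proj₁_appStep_sub hb hν0 hx hy hx' hy'
  obtain ⟨ε₂, h₂, hε₂⟩ := hf.inner_proj₂_appStep_sub hb hν0 hx' hy'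
  have hu' : proj₁ (appStep f ν y - appStep f ν x) = (s ^ (2 * t) * s ^ 2) • proj₁ v' := by
    rw [proj₁_rescale hs0.ne' (t + 1), ← hv', ← pow_add, mul_add_one]
  have hy₁ : proj₂ (y - x) = (s ^ (2 * t) * s) • proj₂ v := by
    rw [proj₂_rescale hs0.ne' t, ← hv, pow_succ]
  have hy₁' : proj₂ (appStep f ν y - appStep f ν x) = (s ^ (2 * t) * s * s ^ 2) • proj₂ v' := by
    rw [proj₂_rescale hs0.ne' (t + 1), ← hv', ← pow_succ, ← pow_add]
    congr 2
  have hu₁' : proj₁ (appStep f ν y - appStep f ν x) = (s ^ (2 * t) * s * s) • proj₁ v' := by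
    rw [hu', pow_two, mul_assoc]
  have hstep₁ := h₁ (v' - v)
  have hstep₂ := h₂ (v' - v)
  rw [hu', hy₁] at hε₁
  rw [hu', proj₁_rescale hs0.ne' t (y - x), ← hv, hy₁, map_sub] at hstep₁
  rw [hy₁', hu₁'] at hε₂
  rw [hy₁', hu₁', hy₁, map_sub] at hstep₂
  have henergy := scaledEnergy_rescaled_step (hf.isSymmetric_hess z) (hf.norm_hess_le z) hν0
    (by linarith) hs0 hs ha hsa (by positivity) (by positivity) hstep₁ hε₁ hstep₂ hε₂
  rw [norm_sq_eq_proj (v' - v), norm_sq_eq_proj v, norm_sq_eq_proj v', map_sub, map_sub]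
  refine henergy.trans_eq ?_
  ring

lemma scaledEnergy_rescale_zero_le (hf : BlockSmooth f M ρ) (hγ : 0 ≤ γ) {s : ℝ} (hs : 1 ≤ s)
    (hsγ : (s ^ 2 - 1) * (8 * M) ≤ γ / 2) {w : Vec m n} (hneg : ⟪w, hess f z w⟫ ≤ -γ * ‖w‖ ^ 2) :
    scaledEnergy (hess f z) s (γ / 2) (proj₁ (rescale s 0 w)) (proj₂ (rescale s 0 w))
      ≤ -(γ / 8 * ‖w‖ ^ 2) := by
  have hs0 : s ≠ 0 := by positivity
  have hu : proj₁ (rescale s 0 w) = proj₁ w := by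
    rw [proj₁_rescale hs0 0 w, mul_zero, pow_zero, one_smul]
  have hy : proj₂ (rescale s 0 w) = s⁻¹ • proj₂ w := by
    rw [proj₂_rescale hs0 0 w, mul_zero, zero_add, pow_one, inv_smul_smul₀ hs0]
  rw [hu, hy, norm_sq_eq_proj w]
  refine scaledEnergy_le_of_neg_curv (hf.isSymmetric_hess z) (hf.norm_hess_le z) hs
    (by linarith) (by positivity) le_rfl ?_
  rwa [proj₁_add_proj₂, ← norm_sq_eq_proj]

lemma norm_sub_sq_le_norm_rescale_iterate_sub_sq (hf : BlockSmooth f M ρ)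
    (hb : BddBelow (Set.range f)) (hν : 8 * M ≤ ν) (hγ : 0 < γ) {s : ℝ} (hs1 : 1 ≤ s)
    (hs2 : s ^ 2 ≤ 2) (hsa : ν * (s ^ 2 - 1) = γ / 2)
    (hneg : ⟪y - x, hess f z (y - x)⟫ ≤ -γ * ‖y - x‖ ^ 2) {T : ℕ}
    (hx : ∀ t ≤ T, ‖(appStep f ν)^[t] x - z‖ ≤ S) (hy : ∀ t ≤ T, ‖(appStep f ν)^[t] y - z‖ ≤ S)
    {R : ℝ} (hRγ : 16 / γ ≤ R) (hRT : 4 * T / ν ≤ R)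
    (hsmall : 4 * (T / ν) * (64 * (ρ * S) ^ 2) * R ≤ 1) :
    γ * ‖y - x‖ ^ 2
      ≤ 64 * M * ‖rescale s T ((appStep f ν)^[T] y - (appStep f ν)^[T] x)‖ ^ 2 := by
  have hν0 : 0 < ν := by linarith [hf.pos]
  let v (t : ℕ) : Vec m n := rescale s t ((appStep f ν)^[t] y - (appStep f ν)^[t] x)
  let q (t : ℕ) : ℝ := -scaledEnergy (hess f z) s (γ / 2) (proj₁ (v t)) (proj₂ (v t))
  have hstart : γ / 8 * ‖y - x‖ ^ 2 ≤ q 0 := by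
    refine le_neg_of_le_neg (hf.scaledEnergy_rescale_zero_le hγ.le hs1 ?_ hneg)
    rw [← hsa, mul_comm]
    gcongr
    nlinarith
  have hv0 : ‖rescale s 0 (y - x)‖ ^ 2 ≤ ‖y - x‖ ^ 2 := by
    simpa using pow_mul_norm_rescale_sq_le hs1 0 (y - x)
  have hhalf : q 0 / 2 ≤ q T := by
    refine half_le_of_increments (v := v) (γ := γ / 8) (R := R) (θ := 64 * (ρ * S) ^ 2) hν0
      (by positivity) (by positivity) (fun k hk => ?_)
      (le_trans (mul_le_mul_of_nonneg_left hv0 (by positivity)) hstart)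
      (le_trans (by field_simp; norm_num) hRγ) hRT hsmall
    have hx' := hx (k + 1) hk
    have hy' := hy (k + 1) hk
    rw [Function.iterate_succ_apply'] at hx' hy'
    have hstep := hf.scaledEnergy_rescale_step hb hν (by positivity) hs2 (by positivity) hsa
      (hx k hk.le) (hy k hk.le) hx' hy' k (v := v k) (v' := v (k + 1)) rfl
      (by simp only [v, Function.iterate_succ_apply'])
    simp only [q]
    linarith
  have hfinal : q T ≤ 4 * M * ‖v T‖ ^ 2 := by
    rw [norm_sq_eq_proj]
    exact (neg_scaledEnergy_le (hf.norm_hess_le z) (by positivity) hs2 (by positivity) _ _).trans_eq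
      (by ring)
  linarith

lemma growth_le (hf : BlockSmooth f M ρ) (hb : BddBelow (Set.range f)) (hν : 8 * M ≤ ν)
    (hγ : 0 < γ) (hγM : γ ≤ M) (he : ‖e‖ = 1) (hneg : ⟪e, hess f z e⟫ ≤ -γ) {α : ℝ}
    (hxy : y - x = α • e) {T : ℕ} (hx : ∀ t ≤ T, ‖(appStep f ν)^[t] x - z‖ ≤ S)
    (hy : ∀ t ≤ T, ‖(appStep f ν)^[t] y - z‖ ≤ S) {R : ℝ} (hRγ : 16 / γ ≤ R)
    (hRT : 4 * T / ν ≤ R) (hsmall : 4 * (T / ν) * (64 * (ρ * S) ^ 2) * R ≤ 1) :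
    (1 + γ / (2 * ν)) ^ (2 * T) * γ * α ^ 2 ≤ 256 * M * S ^ 2 := by
  have hM := hf.pos
  have hν0 : 0 < ν := by linarith
  obtain ⟨s, hs1, hs⟩ : ∃ s : ℝ, 1 ≤ s ∧ s ^ 2 = 1 + γ / (2 * ν) := by
    have hpos : 0 ≤ γ / (2 * ν) := by positivity
    exact ⟨√(1 + γ / (2 * ν)), Real.one_le_sqrt.2 (by linarith), Real.sq_sqrt (by linarith)⟩
  have hsa : ν * (s ^ 2 - 1) = γ / 2 := by rw [hs]; field_simp; ring
  have hs2 : s ^ 2 ≤ 2 := by nlinarith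
  have hnorm : ‖y - x‖ ^ 2 = α ^ 2 := by
    rw [hxy, norm_smul, he, mul_one, Real.norm_eq_abs, sq_abs]
  have hcurv : ⟪y - x, hess f z (y - x)⟫ ≤ -γ * ‖y - x‖ ^ 2 := by
    rw [hnorm, hxy, map_smul, real_inner_smul_left, real_inner_smul_right]
    nlinarith [sq_nonneg α]
  set w := (appStep f ν)^[T] y - (appStep f ν)^[T] x with hw
  have hwS : ‖w‖ ≤ 2 * S :=
    calc ‖w‖ = ‖((appStep f ν)^[T] y - z) - ((appStep f ν)^[T] x - z)‖ := by
          rw [hw, sub_sub_sub_cancel_right]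
      _ ≤ S + S := (norm_sub_le _ _).trans (add_le_add (hy T le_rfl) (hx T le_rfl))
      _ = 2 * S := by ring
  calc (1 + γ / (2 * ν)) ^ (2 * T) * γ * α ^ 2 = s ^ (4 * T) * (γ * ‖y - x‖ ^ 2) := by
        rw [← hs, hnorm, ← pow_mul, ← mul_assoc 2 2 T]; ring
    _ ≤ s ^ (4 * T) * (64 * M * ‖rescale s T w‖ ^ 2) := by
        refine mul_le_mul_of_nonneg_left ?_ (by positivity)
        exact hf.norm_sub_sq_le_norm_rescale_iterate_sub_sq hb hν hγ hs1 hs2 hsa hcurv hx hy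
          hRγ hRT hsmall
    _ = 64 * M * (s ^ (4 * T) * ‖rescale s T w‖ ^ 2) := by ring
    _ ≤ 64 * M * (2 * S) ^ 2 := by
        gcongr
        exact (pow_mul_norm_rescale_sq_le hs1 T w).trans (by gcongr)
    _ = 256 * M * S ^ 2 := by ring

lemma apply_add_le_of_norm_appStep_sub_le (hf : BlockSmooth f M ρ) (hb : BddBelow (Set.range f))
    (hν : 2 * M ≤ ν) {ζ : Vec m n} {r g : ℝ} (hg : ‖appStep f ν z - z‖ ≤ g / ν) (hζ : ‖ζ‖ ≤ r) :
    f (z + ζ) ≤ f z + (4 * g * r + M * r ^ 2) := by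
  have hM := hf.pos
  have hν0 : 0 < ν := by linarith
  have hgrad : ‖∇ f z‖ ≤ 4 * g :=
    calc ‖∇ f z‖ ≤ 4 * ν * ‖appStep f ν z - z‖ := hf.norm_grad_le hb hν z
      _ ≤ 4 * ν * (g / ν) := by gcongr
      _ = 4 * g := by field_simp
  calc f (z + ζ) ≤ f z + ⟪∇ f z, ζ⟫ + 2 * M / 2 * ‖ζ‖ ^ 2 :=
        apply_add_le_of_lipschitz_gradient hf.diff hf.norm_grad_sub_le z ζ
    _ ≤ f z + ‖∇ f z‖ * ‖ζ‖ + 2 * M / 2 * ‖ζ‖ ^ 2 := by gcongr; exact real_inner_le_norm _ _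
    _ ≤ f z + 4 * g * r + 2 * M / 2 * r ^ 2 := by
        have := (norm_nonneg _).trans hgrad
        gcongr
    _ = f z + (4 * g * r + M * r ^ 2) := by ring

lemma norm_iterate_sub_le (hf : BlockSmooth f M ρ) (hb : BddBelow (Set.range f))
    (hν : 2 * M ≤ ν) {ζ : Vec m n} {r g φ F : ℝ} {T : ℕ} (hg : ‖appStep f ν z - z‖ ≤ g / ν)
    (hζ : ‖ζ‖ ≤ r) (hstuck : -φ < f ((appStep f ν)^[T] (z + ζ)) - f z)
    (hF : 4 * g * r + M * r ^ 2 + φ ≤ F) (hrS : 2 * r ≤ S) (hS : 8 * (T / ν) * F ≤ S ^ 2)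
    {t : ℕ} (ht : t ≤ T) : ‖(appStep f ν)^[t] (z + ζ) - z‖ ≤ S := by
  have hν0 : 0 < ν := by linarith [hf.pos]
  have hr : 0 ≤ r := (norm_nonneg _).trans hζ
  have hdescent := appStep_le hf.diff.continuous hb hν0
  have hdrop : f (z + ζ) - f ((appStep f ν)^[t] (z + ζ)) ≤ F := by
    have hmono := antitone_iterate_of_descent hν0.le hdescent (z + ζ) ht
    linarith [hf.apply_add_le_of_norm_appStep_sub_le hb hν hg hζ]
  have hdrop0 : 0 ≤ f (z + ζ) - f ((appStep f ν)^[t] (z + ζ)) :=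
    sub_nonneg.2 (antitone_iterate_of_descent hν0.le hdescent (z + ζ) (Nat.zero_le t))
  have hmove : ‖(appStep f ν)^[t] (z + ζ) - (z + ζ)‖ ≤ S / 2 := by
    refine le_of_sq_le_sq ?_ (by linarith)
    calc ‖(appStep f ν)^[t] (z + ζ) - (z + ζ)‖ ^ 2
        = 2 / ν * (ν / 2 * ‖(appStep f ν)^[t] (z + ζ) - (z + ζ)‖ ^ 2) := by field_simp
      _ ≤ 2 / ν * (t * (f (z + ζ) - f ((appStep f ν)^[t] (z + ζ)))) := by
          refine mul_le_mul_of_nonneg_left ?_ (by positivity)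
          exact norm_iterate_sub_sq_le_of_descent hν0.le hdescent (z + ζ) t
      _ ≤ 2 / ν * (T * F) := by gcongr
      _ = 8 * (T / ν) * F / 4 := by ring
      _ ≤ (S / 2) ^ 2 := by linarith
  calc ‖(appStep f ν)^[t] (z + ζ) - z‖
      = ‖((appStep f ν)^[t] (z + ζ) - (z + ζ)) + ζ‖ := by congr 1; abel
    _ ≤ S / 2 + r := (norm_add_le _ _).trans (add_le_add hmove hζ)
    _ ≤ S := by linarith

end BlockSmooth

end Escape

section Volume

open scoped Pointwise

lemma one_add_inv_pow_le_three {d : ℕ} (hd : d ≠ 0) : (1 + (d : ℝ)⁻¹) ^ d ≤ 3 :=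
  calc (1 + (d : ℝ)⁻¹) ^ d ≤ Real.exp (d : ℝ)⁻¹ ^ d := by
        gcongr
        rw [add_comm]
        exact Real.add_one_le_exp _
    _ = Real.exp 1 := by
        rw [← Real.exp_nat_mul, mul_inv_cancel₀ (Nat.cast_ne_zero.2 hd)]
    _ ≤ 3 := Real.exp_one_lt_three.le

variable {E : Type*} [NormedAddCommGroup E] {e : E} {W : Set E} {r r₀ : ℝ}

lemma vadd_subset_closedBall_of_norm_le {v : E} {s : ℝ} (hv : ‖v‖ ≤ s)
    (hW : W ⊆ Metric.closedBall 0 r) : v +ᵥ W ⊆ Metric.closedBall 0 (s + r) := by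
  rintro - ⟨x, hx, rfl⟩
  rw [mem_closedBall_zero_iff]
  exact (norm_add_le v x).trans (add_le_add hv (mem_closedBall_zero_iff.1 (hW hx)))

variable [NormedSpace ℝ E]

lemma pairwise_disjoint_vadd_of_thin (hr₀ : 0 < r₀)
    (hthin : ∀ x ∈ W, ∀ y ∈ W, ∀ α : ℝ, y - x = α • e → α < r₀) :
    Pairwise (Function.onFun Disjoint fun k : ℕ => ((k * r₀) • e) +ᵥ W) := by
  refine (pairwise_disjoint_on _).2 fun i j hij => Set.disjoint_left.2 ?_
  rintro - ⟨y, hy, rfl⟩ ⟨x, hx, hxy⟩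
  simp only [vadd_eq_add] at hxy
  have hlt := hthin x hx y hy (((j : ℝ) - i) * r₀) (by linear_combination (norm := module) -hxy)
  have hij : (i : ℝ) + 1 ≤ j := by exact_mod_cast hij
  nlinarith

variable [MeasurableSpace E] [BorelSpace E] [FiniteDimensional ℝ E] (μ : Measure E)
  [μ.IsAddHaarMeasure] {K : ℕ}

-- A thin set has `K` disjoint translates along `e` in a ball of radius `(1 + 1 / d) * r`.
lemma mul_measure_le_of_thin (hK : K ≠ 0) (hr : 0 < r) (he : ‖e‖ = 1) (hW : MeasurableSet W)
    (hWr : W ⊆ Metric.closedBall 0 r)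
    (hthin : ∀ x ∈ W, ∀ y ∈ W, ∀ α : ℝ, y - x = α • e → α < r / (Module.finrank ℝ E * K)) :
    K * μ W ≤ 3 * μ (Metric.closedBall 0 r) := by
  set d := Module.finrank ℝ E
  have hd0 : d ≠ 0 := by
    have : Nontrivial E := ⟨e, 0, fun h => by simp [h] at he⟩
    exact Module.finrank_pos.ne'
  set r₀ := r / (d * K) with hr₀
  have hr₀pos : 0 < r₀ := by positivity
  have hsub : (⋃ k ∈ Finset.range K, ((k * r₀) • e) +ᵥ W)
      ⊆ Metric.closedBall 0 ((1 + (d : ℝ)⁻¹) * r) := by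
    refine Set.iUnion₂_subset fun k hk => ?_
    have hshift : ‖(k * r₀) • e‖ ≤ (d : ℝ)⁻¹ * r :=
      calc ‖(k * r₀) • e‖ = k * r₀ := by
            rw [norm_smul, he, mul_one, Real.norm_of_nonneg (by positivity)]
        _ ≤ K * r₀ := by gcongr; exact (Finset.mem_range.1 hk).le
        _ = (d : ℝ)⁻¹ * r := by rw [hr₀]; field_simp
    refine (vadd_subset_closedBall_of_norm_le hshift hWr).trans_eq ?_
    rw [one_add_mul, add_comm]
  calc K * μ W = ∑ k ∈ Finset.range K, μ (((k * r₀) • e) +ᵥ W) := by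
        simp only [measure_vadd, Finset.sum_const, Finset.card_range, nsmul_eq_mul]
    _ = μ (⋃ k ∈ Finset.range K, ((k * r₀) • e) +ᵥ W) :=
        (measure_biUnion_finset
          (fun i _ j _ hij => pairwise_disjoint_vadd_of_thin hr₀pos hthin hij)
          fun _ _ => hW.const_vadd _).symm
    _ ≤ μ (Metric.closedBall 0 ((1 + (d : ℝ)⁻¹) * r)) := measure_mono hsub
    _ = ENNReal.ofReal ((1 + (d : ℝ)⁻¹) ^ d) * μ (Metric.closedBall 0 r) :=
        Measure.addHaar_closedBall_mul μ 0 (by positivity) hr.le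
    _ ≤ ENNReal.ofReal 3 * μ (Metric.closedBall 0 r) := by
        gcongr
        exact one_add_inv_pow_le_three hd0
    _ = 3 * μ (Metric.closedBall 0 r) := by norm_num

lemma cond_closedBall_le_of_thin (hK : K ≠ 0) (hr : 0 < r) (he : ‖e‖ = 1)
    (hW : MeasurableSet W)
    (hthin : ∀ x ∈ W, ∀ y ∈ W, ‖x‖ ≤ r → ‖y‖ ≤ r → ∀ α : ℝ, y - x = α • e →
      α < r / (Module.finrank ℝ E * K)) :
    cond μ (Metric.closedBall 0 r) W ≤ 3 / K := by
  have hthick := mul_measure_le_of_thin μ hK hr he (measurableSet_closedBall.inter hW)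
    Set.inter_subset_left fun x hx y hy =>
      hthin x hx.2 y hy.2 (mem_closedBall_zero_iff.1 hx.1) (mem_closedBall_zero_iff.1 hy.1)
  rw [cond_apply measurableSet_closedBall, ENNReal.le_div_iff_mul_le (by simp [hK]) (by simp)]
  calc (μ (Metric.closedBall 0 r))⁻¹ * μ (Metric.closedBall 0 r ∩ W) * K
      = (μ (Metric.closedBall 0 r))⁻¹ * (K * μ (Metric.closedBall 0 r ∩ W)) := by ring
    _ ≤ (μ (Metric.closedBall 0 r))⁻¹ * (3 * μ (Metric.closedBall 0 r)) := by gcongr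
    _ = 3 * ((μ (Metric.closedBall 0 r))⁻¹ * μ (Metric.closedBall 0 r)) := by ring
    _ = 3 := by
        rw [ENNReal.inv_mul_cancel (Metric.measure_closedBall_pos μ 0 hr).ne'
          measure_closedBall_lt_top.ne, mul_one]

end Volume

section Trajectory

variable {m n : ℕ} {f : Vec m n → ℝ} {ν g φ κ : ℝ} {τ : ℕ} {ξ : ℕ → Vec m n} {x₀ : Vec m n}

/-- The algorithm is running before iteration `t` with iterate `x`, it is allowed to perturb `x`
(the last perturbation, if any, was made more than `τ` iterations ago), and so far `f` has decreased
by at least `κ` per iteration. -/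
structure FreeAt (f : Vec m n → ℝ) (ν g φ : ℝ) (τ : ℕ) (ξ : ℕ → Vec m n) (x₀ : Vec m n) (κ : ℝ)
    (t : ℕ) (x : Vec m n) : Prop where
  run_eq : ∃ last, run f ν g φ τ ξ x₀ t = .running x last ∧ ∀ q ∈ last, q.1 + τ < t
  decrease : f x + t * κ ≤ f x₀

lemma freeAt_zero : FreeAt f ν g φ τ ξ x₀ κ 0 x₀ :=
  ⟨⟨none, rfl, fun _ h => absurd h (Option.not_mem_none _)⟩, by simp⟩

lemma run_succ_of_pending {t tp : ℕ} {x xp : Vec m n}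
    (hrun : run f ν g φ τ ξ x₀ t = .running x (some (tp, xp))) (hpending : t ≤ tp + τ) :
    run f ν g φ τ ξ x₀ (t + 1) =
      open Classical in if t = tp + τ ∧ f x - f xp > -φ then .returned tp xp
        else .running (appStep f ν x) (some (tp, xp)) := by
  have hno : ¬ (‖appStep f ν x - x‖ ≤ g / ν ∧ ∀ q ∈ some (tp, xp), q.1 + τ < t) :=
    fun h => absurd (h.2 (tp, xp) rfl) hpending.not_gt
  rw [run, hrun]
  simp only [iteration, if_neg hno]

namespace FreeAt

variable {t : ℕ} {x : Vec m n}

lemma run_add_of_short (h : FreeAt f ν g φ τ ξ x₀ κ t x) (hshort : ‖appStep f ν x - x‖ ≤ g / ν)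
    {j : ℕ} (hj : j < τ) : run f ν g φ τ ξ x₀ (t + (j + 1))
      = .running ((appStep f ν)^[j + 1] (x + ξ t)) (some (t, x)) := by
  obtain ⟨last, hrun, hfree⟩ := h.run_eq
  induction j with
  | zero =>
    have hcheck (y : Vec m n) : ¬ (t = t + τ ∧ f y - f x > -φ) := fun h => by omega
    rw [zero_add, run, hrun]
    simp only [iteration, if_pos (And.intro hshort hfree), if_neg (hcheck _),
      Function.iterate_one]
  | succ j ih =>
    rw [← add_assoc, run_succ_of_pending (ih (by omega)) (by omega),
      if_neg (fun h => by omega), ← Function.iterate_succ_apply' (appStep f ν)]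

lemma succ_of_long (h : FreeAt f ν g φ τ ξ x₀ κ t x)
    (hA : ∀ x, f (appStep f ν x) + ν / 2 * ‖appStep f ν x - x‖ ^ 2 ≤ f x) (hν : 0 < ν)
    (hg : 0 ≤ g) (hκ : κ ≤ g ^ 2 / (2 * ν)) (hlong : g / ν < ‖appStep f ν x - x‖) :
    FreeAt f ν g φ τ ξ x₀ κ (t + 1) (appStep f ν x) := by
  obtain ⟨last, hrun, hfree⟩ := h.run_eq
  refine ⟨⟨last, ?_, fun q hq => (hfree q hq).trans t.lt_succ_self⟩, ?_⟩
  · have hno : ¬ (‖appStep f ν x - x‖ ≤ g / ν ∧ ∀ q ∈ last, q.1 + τ < t) :=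
      fun h => absurd h.1 hlong.not_ge
    rw [run, hrun]
    rcases last with _ | ⟨tp, xp⟩
    · simp only [iteration, if_neg hno]
    · have hcheck : ¬ (t = tp + τ ∧ f x - f xp > -φ) := fun h => (hfree (tp, xp) rfl).ne' h.1
      simp only [iteration, if_neg hno, if_neg hcheck]
  · have hstep : κ ≤ ν / 2 * ‖appStep f ν x - x‖ ^ 2 :=
      calc κ ≤ ν / 2 * (g / ν) ^ 2 := hκ.trans_eq (by field_simp)
        _ ≤ ν / 2 * ‖appStep f ν x - x‖ ^ 2 := by gcongr
    push_cast
    linarith [h.decrease, hA x]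

lemma add_of_short_of_decrease (h : FreeAt f ν g φ τ ξ x₀ κ t x)
    (hA : ∀ x, f (appStep f ν x) + ν / 2 * ‖appStep f ν x - x‖ ^ 2 ≤ f x) (hν : 0 ≤ ν)
    (hτ : 0 < τ) (hκ : κ * (τ + 1) ≤ φ) (hshort : ‖appStep f ν x - x‖ ≤ g / ν)
    (hdecrease : f ((appStep f ν)^[τ] (x + ξ t)) - f x ≤ -φ) :
    FreeAt f ν g φ τ ξ x₀ κ (t + τ + 1) ((appStep f ν)^[τ + 1] (x + ξ t)) := by
  obtain ⟨j, rfl⟩ : ∃ j, τ = j + 1 := ⟨τ - 1, by omega⟩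
  refine ⟨⟨some (t, x), ?_, ?_⟩, ?_⟩
  · rw [run_succ_of_pending (h.run_add_of_short hshort j.lt_succ_self) le_rfl,
      if_neg (fun h => h.2.not_ge hdecrease), ← Function.iterate_succ_apply' (appStep f ν)]
  · rintro q ⟨⟩
    exact Nat.lt_succ_self _
  · have hlast := antitone_iterate_of_descent hν hA (x + ξ t) (j + 1).le_succ
    push_cast at hκ hlast ⊢
    linarith [h.decrease]

lemma returnsAt (h : FreeAt f ν g φ τ ξ x₀ κ t x) (hτ : 0 < τ)
    (hshort : ‖appStep f ν x - x‖ ≤ g / ν)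
    (hstuck : -φ < f ((appStep f ν)^[τ] (x + ξ t)) - f x) :
    ReturnsAt f ν g φ τ ξ x₀ (t + τ) t x := by
  obtain ⟨j, rfl⟩ : ∃ j, τ = j + 1 := ⟨τ - 1, by omega⟩
  have hrun := h.run_add_of_short hshort j.lt_succ_self
  exact ⟨⟨_, _, hrun⟩, by rw [run_succ_of_pending hrun le_rfl, if_pos ⟨rfl, hstuck⟩]⟩

end FreeAt

lemma exists_freeAt_stuck (hb : BddBelow (Set.range f))
    (hA : ∀ x, f (appStep f ν x) + ν / 2 * ‖appStep f ν x - x‖ ^ 2 ≤ f x) (hν : 0 < ν)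
    (hg : 0 ≤ g) (hκ : 0 < κ) (hτ : 0 < τ) (hκg : κ ≤ g ^ 2 / (2 * ν)) (hκφ : κ * (τ + 1) ≤ φ) :
    ∃ t x, FreeAt f ν g φ τ ξ x₀ κ t x ∧ ‖appStep f ν x - x‖ ≤ g / ν ∧
      -φ < f ((appStep f ν)^[τ] (x + ξ t)) - f x := by
  by_contra! hno
  have hforever (N : ℕ) : ∃ t x, N ≤ t ∧ FreeAt f ν g φ τ ξ x₀ κ t x := by
    induction N with
    | zero => exact ⟨0, x₀, le_rfl, freeAt_zero⟩
    | succ N ih =>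
      obtain ⟨t, x, ht, h⟩ := ih
      rcases lt_or_ge (g / ν) ‖appStep f ν x - x‖ with hlong | hshort
      · exact ⟨t + 1, _, by omega, h.succ_of_long hA hν hg hκg hlong⟩
      · exact ⟨t + τ + 1, _, by omega,
          h.add_of_short_of_decrease hA hν.le hτ hκφ hshort (hno t x h hshort)⟩
  obtain ⟨B, hB⟩ := hb
  obtain ⟨N, hN⟩ := exists_nat_gt ((f x₀ - B) / κ)
  obtain ⟨t, x, ht, h⟩ := hforever N
  rw [div_lt_iff₀ hκ] at hN
  have hNt : (N : ℝ) * κ ≤ t * κ := by gcongr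
  linarith [h.decrease, hB ⟨x, rfl⟩]

end Trajectory

section Measurability

lemma indepFun_of_dependsOn {Ω E β ι : Type*} [MeasurableSpace Ω] [MeasurableSpace E]
    [MeasurableSpace β] {P : Measure Ω} {ξ : ι → Ω → E} (hξ : ∀ i, Measurable (ξ i))
    (hind : iIndepFun ξ P) {s : Finset ι} {i : ι} (hi : i ∉ s) {F : (ι → E) → β}
    (hF : Measurable F) (hdep : DependsOn F s) : IndepFun (fun ω => F (ξ · ω)) (ξ i) P := by
  classical
  have := hind.isProbabilityMeasure
  obtain ⟨ω₀⟩ : Nonempty Ω := P.nonempty_of_neZero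
  let extend (y : s → E) : ι → E := Function.updateFinset (ξ · ω₀) s y
  have hblocks := hind.indepFun_finset s {i} (Finset.disjoint_singleton_right.2 hi) hξ
  refine (hblocks.comp (hF.comp (measurable_updateFinset : Measurable extend))
    (measurable_pi_apply (⟨i, Finset.mem_singleton_self i⟩ : ({i} : Finset ι)))).congr
    (.of_forall fun ω => hdep fun j hj => ?_) (.of_forall fun _ => rfl)
  exact dif_pos hj

lemma measure_mem_le_of_indepFun {Ω α β : Type*} [MeasurableSpace Ω] [MeasurableSpace α]
    [MeasurableSpace β] {P : Measure Ω} [IsProbabilityMeasure P] {X : Ω → α} {Y : Ω → β}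
    (hX : Measurable X) (hY : Measurable Y) (hXY : IndepFun X Y P) {B : Set (α × β)}
    (hB : MeasurableSet B) {δ : ENNReal} (hδ : ∀ x, P.map Y (Prod.mk x ⁻¹' B) ≤ δ) :
    P {ω | (X ω, Y ω) ∈ B} ≤ δ := by
  have := Measure.isProbabilityMeasure_map hX.aemeasurable (μ := P)
  have := Measure.isProbabilityMeasure_map hY.aemeasurable (μ := P)
  calc P {ω | (X ω, Y ω) ∈ B} = P.map (fun ω => (X ω, Y ω)) B :=
        (Measure.map_apply (hX.prodMk hY) hB).symm
    _ = ∫⁻ x, P.map Y (Prod.mk x ⁻¹' B) ∂P.map X := by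
        rw [(indepFun_iff_map_prod_eq_prod_map_map hX.aemeasurable hY.aemeasurable).1 hXY,
          Measure.prod_apply hB]
    _ ≤ ∫⁻ _, δ ∂P.map X := lintegral_mono hδ
    _ = δ := by rw [lintegral_const, measure_univ, mul_one]

variable {m n : ℕ}

namespace State

/-- A state, split by constructor into its data. -/
def equivSum : State m n ≃ Vec m n ⊕ (Vec m n × ℕ × Vec m n) ⊕ (ℕ × Vec m n) where
  toFun
    | .running x none => .inl x
    | .running x (some q) => .inr (.inl (x, q))
    | .returned tp xp => .inr (.inr (tp, xp))
  invFun
    | .inl x => .running x none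
    | .inr (.inl (x, q)) => .running x (some q)
    | .inr (.inr (tp, xp)) => .returned tp xp
  left_inv := by rintro (⟨_, _ | _⟩ | _) <;> rfl
  right_inv := by rintro (_ | _ | _) <;> rfl

instance : MeasurableSpace (State m n) := .comap equivSum inferInstance

/-- The measurable structure on states is that of the disjoint union of their possible data. -/
def measurableEquivSum : State m n ≃ᵐ Vec m n ⊕ (Vec m n × ℕ × Vec m n) ⊕ (ℕ × Vec m n) where
  toEquiv := equivSum
  measurable_toFun := comap_measurable _
  measurable_invFun := by
    rw [measurable_comap_iff]
    exact (funext equivSum.apply_symm_apply : equivSum ∘ equivSum.symm = id) ▸ measurable_id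

lemma measurable_running_none : Measurable fun x : Vec m n => State.running x none :=
  measurableEquivSum.symm.measurable.comp measurable_inl

lemma measurable_running_some :
    Measurable fun p : Vec m n × ℕ × Vec m n => State.running p.1 (some p.2) :=
  measurableEquivSum.symm.measurable.comp (measurable_inr.comp measurable_inl)

lemma measurable_returned : Measurable fun q : ℕ × Vec m n => State.returned q.1 q.2 :=
  measurableEquivSum.symm.measurable.comp (measurable_inr.comp measurable_inr)

lemma measurable_of_constructors {α β : Type*} [MeasurableSpace α] [MeasurableSpace β]
    {G : α × State m n → β} (h₁ : Measurable fun p : α × Vec m n => G (p.1, .running p.2 none))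
    (h₂ : Measurable fun p : α × Vec m n × ℕ × Vec m n => G (p.1, .running p.2.1 (some p.2.2)))
    (h₃ : Measurable fun p : α × ℕ × Vec m n => G (p.1, .returned p.2.1 p.2.2)) :
    Measurable G := by
  let split : α × State m n ≃ᵐ
      (α × Vec m n) ⊕ (α × Vec m n × ℕ × Vec m n) ⊕ (α × ℕ × Vec m n) :=
    ((MeasurableEquiv.refl α).prodCongr measurableEquivSum).trans
      (MeasurableEquiv.prodSumDistrib _ _ _ |>.trans
        ((MeasurableEquiv.refl _).sumCongr (MeasurableEquiv.prodSumDistrib _ _ _)))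
  exact split.symm.measurable_comp_iff.1 (measurable_fun_sum h₁ (measurable_fun_sum h₂ h₃))

/-- The current iterate of a running algorithm, or the returned point. -/
def point : State m n → Vec m n
  | .running x _ => x
  | .returned _ xp => xp

lemma measurable_point : Measurable (point : State m n → Vec m n) :=
  have h : Measurable fun p : Unit × State m n => p.2.point := measurable_of_constructors
    measurable_snd (measurable_fst.comp measurable_snd) (measurable_snd.comp measurable_snd)
  h.comp (measurable_prodMk_left (x := ()))

end State

variable {f : Vec m n → ℝ} {ν g φ : ℝ} {τ : ℕ} {x₀ : Vec m n}

/-- The end of iteration `t` when the last perturbation was that of `p.2.2` at time `p.2.1`, as a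
function of these data and of the current iterate `p.1`: stop or make a sweep. -/
def stopOrSweep (f : Vec m n → ℝ) (ν φ : ℝ) (τ t : ℕ) (p : Vec m n × ℕ × Vec m n) : State m n :=
  open Classical in if t = p.2.1 + τ ∧ f p.1 - f p.2.2 > -φ then .returned p.2.1 p.2.2
    else .running (appStep f ν p.1) (some p.2)

lemma measurable_stopOrSweep (hA : Measurable (appStep f ν)) (hf : Measurable f) (t : ℕ) :
    Measurable (stopOrSweep f ν φ τ t) := by
  refine Measurable.ite (.inter ?_ ?_) ?_ ?_
  · exact measurableSet_eq_fun measurable_const (by fun_prop)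
  · exact measurableSet_lt measurable_const
      ((hf.comp measurable_fst).sub (hf.comp (measurable_snd.comp measurable_snd)))
  · exact State.measurable_returned.comp measurable_snd
  · exact State.measurable_running_some.comp ((hA.comp measurable_fst).prodMk measurable_snd)

lemma iteration_running_none (ξ : ℕ → Vec m n) (t : ℕ) (x : Vec m n) :
    iteration f ν g φ τ ξ t (.running x none) =
      open Classical in if ‖appStep f ν x - x‖ ≤ g / ν then stopOrSweep f ν φ τ t (x + ξ t, t, x)
        else .running (appStep f ν x) none := by
  by_cases h : ‖appStep f ν x - x‖ ≤ g / ν <;> simp [iteration, stopOrSweep, h]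

lemma iteration_running_some (ξ : ℕ → Vec m n) (t : ℕ) (x : Vec m n) (q : ℕ × Vec m n) :
    iteration f ν g φ τ ξ t (.running x (some q)) =
      open Classical in if ‖appStep f ν x - x‖ ≤ g / ν ∧ q.1 + τ < t
        then stopOrSweep f ν φ τ t (x + ξ t, t, x) else stopOrSweep f ν φ τ t (x, q) := by
  by_cases h : ‖appStep f ν x - x‖ ≤ g / ν ∧ q.1 + τ < t <;> simp [iteration, stopOrSweep, h]

lemma measurable_iteration (hA : Measurable (appStep f ν)) (hf : Measurable f) (t : ℕ) :
    Measurable fun p : (ℕ → Vec m n) × State m n => iteration f ν g φ τ p.1 t p.2 := by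
  have hcheck := measurable_stopOrSweep (φ := φ) (τ := τ) hA hf t
  have hstep : Measurable fun x => ‖appStep f ν x - x‖ := (hA.sub measurable_id).norm
  refine State.measurable_of_constructors ?_ ?_ ?_
  · simp only [iteration_running_none]
    refine Measurable.ite (measurableSet_le (hstep.comp measurable_snd) measurable_const)
      (hcheck.comp (by fun_prop)) ?_
    exact State.measurable_running_none.comp (hA.comp measurable_snd)
  · simp only [iteration_running_some]
    refine Measurable.ite (.inter ?_ ?_) (hcheck.comp (by fun_prop)) (hcheck.comp measurable_snd)
    · exact measurableSet_le (hstep.comp (measurable_fst.comp measurable_snd)) measurable_const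
    · exact measurableSet_lt
        ((measurable_fst.comp (measurable_snd.comp measurable_snd)).add_const τ) measurable_const
  · exact State.measurable_returned.comp measurable_snd

lemma measurable_run (hA : Measurable (appStep f ν)) (hf : Measurable f) (t : ℕ) :
    Measurable fun ξ => run f ν g φ τ ξ x₀ t := by
  induction t with
  | zero => exact measurable_const
  | succ t ih => exact (measurable_iteration hA hf t).comp (measurable_id.prodMk ih)

lemma dependsOn_run (t : ℕ) : DependsOn (fun ξ => run f ν g φ τ ξ x₀ t) (Set.Iio t) := by
  intro ξ ξ' h
  induction t with
  | zero => rfl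
  | succ t ih =>
    change iteration f ν g φ τ ξ t _ = iteration f ν g φ τ ξ' t _
    have hprev : run f ν g φ τ ξ x₀ t = run f ν g φ τ ξ' x₀ t :=
      ih fun i hi => h i (hi.trans t.lt_succ_self)
    rw [hprev]
    rcases run f ν g φ τ ξ' x₀ t with ⟨x, last⟩ | _
    · simp only [iteration, h t t.lt_succ_self]
    · rfl

end Measurability

section Parameters

lemma gam_pos {M ρ ε : ℝ} (hM : 0 < M) (hρ : 0 < ρ) (hε : 0 < ε) : 0 < gam M ρ ε := by
  unfold gam; positivity

lemma gam_pow_three {M ρ ε : ℝ} (h : 0 ≤ M * ρ * ε) : gam M ρ ε ^ 3 = M * ρ * ε := by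
  rw [gam, ← Real.rpow_natCast, ← Real.rpow_mul h]
  norm_num

lemma gam_le {M ρ ε : ℝ} (hM : 0 < M) (hρ : 0 < ρ) (hε : 0 < ε) (h : ε ≤ M ^ 2 / ρ) :
    gam M ρ ε ≤ M := by
  refine le_of_pow_le_pow_left₀ three_ne_zero hM.le ?_
  calc gam M ρ ε ^ 3 = M * (ε * ρ) := by rw [gam_pow_three (by positivity)]; ring
    _ ≤ M * M ^ 2 := by gcongr; exact (le_div_iff₀ hρ).1 h
    _ = M ^ 3 := by ring

lemma exp_half_le_one_add {x : ℝ} (h₀ : 0 ≤ x) (h₁ : x ≤ 1) : Real.exp (x / 2) ≤ 1 + x := by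
  have hexp : Real.exp (x / 2) * (1 - x / 2) ≤ 1 := by
    calc Real.exp (x / 2) * (1 - x / 2) ≤ Real.exp (x / 2) * Real.exp (-(x / 2)) := by
          gcongr; exact Real.one_sub_le_exp_neg _
      _ = 1 := by rw [← Real.exp_add, add_neg_cancel, Real.exp_zero]
  nlinarith

lemma pow_mul_pow_mul_inv_pow_lt_exp {c χ G : ℝ} (hc : 0 < c) (hc' : c ≤ 1 / 100) (hχ : 24 ≤ χ)
    (hG₀ : 0 ≤ G) (hG : G ≤ Real.exp (χ / 6)) :
    χ ^ 22 * G ^ 4 * c⁻¹ ^ 6 < Real.exp (χ / (2 * c)) := by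
  have hχexp : χ ^ 22 ≤ Real.exp (22 * χ) := by
    have : χ ≤ Real.exp χ := by linarith [Real.add_one_le_exp χ]
    calc χ ^ 22 ≤ Real.exp χ ^ 22 := by gcongr
      _ = Real.exp (22 * χ) := by rw [← Real.exp_nat_mul]; norm_num
  have hGexp : G ^ 4 ≤ Real.exp χ := by
    calc G ^ 4 ≤ Real.exp (χ / 6) ^ 4 := by gcongr
      _ = Real.exp (4 * (χ / 6)) := by rw [← Real.exp_nat_mul]; norm_num
      _ ≤ Real.exp χ := by gcongr; linarith
  have hcexp : c⁻¹ ^ 6 < Real.exp (6 * c⁻¹) := by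
    have : c⁻¹ < Real.exp c⁻¹ := by linarith [Real.add_one_le_exp c⁻¹]
    calc c⁻¹ ^ 6 < Real.exp c⁻¹ ^ 6 := by gcongr
      _ = Real.exp (6 * c⁻¹) := by rw [← Real.exp_nat_mul]; norm_num
  calc χ ^ 22 * G ^ 4 * c⁻¹ ^ 6 ≤ Real.exp (22 * χ) * Real.exp χ * c⁻¹ ^ 6 := by gcongr
    _ < Real.exp (22 * χ) * Real.exp χ * Real.exp (6 * c⁻¹) := by gcongr
    _ = Real.exp ((46 * χ * c + 12) / (2 * c)) := by
        rw [← Real.exp_add, ← Real.exp_add]; congr 1; field_simp; ring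
    _ ≤ Real.exp (χ / (2 * c)) := by gcongr; nlinarith

/-- The problem constants `M = L_max`, `ρ`, `ε` and the parameters `c`, `χ`, `P = 𝒫` of the method.
The last two are free here, so that the analysis does not depend on `L`, `δ` and `Δ_f`. -/
structure Params where
  M : ℝ
  ρ : ℝ
  ε : ℝ
  c : ℝ
  χ : ℝ
  P : ℝ
  M_pos : 0 < M
  ρ_pos : 0 < ρ
  ε_pos : 0 < ε
  ε_le : ε ≤ M ^ 2 / ρ
  c_pos : 0 < c
  c_le : c ≤ 1 / 100
  le_χ : 24 ≤ χ
  one_le_P : 1 ≤ P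

namespace Params

variable (p : Params)

/-- The curvature tolerance `γ`. -/
def γ : ℝ := gam p.M p.ρ p.ε

/-- The proximal penalty `ν`. -/
def ν : ℝ := p.M / p.c

/-- The perturbation radius `r`. -/
def r : ℝ := p.c ^ 3 * p.ε / (p.χ ^ 3 * p.M * p.P)

/-- The step length threshold `g_th`. -/
def g : ℝ := p.c ^ 2 * p.ε / (p.χ ^ 3 * p.P)

/-- The decrease threshold `f_th`. -/
def φ : ℝ := p.c ^ 5 * p.ε ^ 2 / (p.M * p.χ ^ 6 * p.P ^ 2)

/-- The waiting time `t_th`. -/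
def τ : ℕ := ⌈p.M * p.χ / (p.c ^ 2 * p.γ)⌉₊

/-- The average decrease of `f` per iteration: the decrease `φ` spread over the `τ + 1` iterations
from a perturbation to the earliest next one. -/
def κ : ℝ := p.φ / (p.τ + 1)

/-- The radius within which a trajectory stays as long as it does not decrease `f` by `φ`. -/
def S : ℝ := 10 * (p.χ / p.c) * √(p.M / p.γ) * p.r

/-- The leading factor `L_max^{5/3} 𝒫² Δ / (ρ^{1/3} ε^{7/3})` of the complexity bound, with its
fractional powers absorbed into `γ`. -/
def budget (Δ : ℝ) : ℝ := p.M ^ 2 * p.P ^ 2 * Δ / (p.γ * p.ε ^ 2)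

lemma χ_pos : 0 < p.χ := by linarith [p.le_χ]

lemma P_pos : 0 < p.P := zero_lt_one.trans_le p.one_le_P

lemma γ_pos : 0 < p.γ := gam_pos p.M_pos p.ρ_pos p.ε_pos

lemma γ_le : p.γ ≤ p.M := gam_le p.M_pos p.ρ_pos p.ε_pos p.ε_le

lemma γ_pow_three : p.γ ^ 3 = p.M * p.ρ * p.ε :=
  gam_pow_three (mul_pos (mul_pos p.M_pos p.ρ_pos) p.ε_pos).le

lemma one_le_M_div_γ : 1 ≤ p.M / p.γ := (one_le_div p.γ_pos).2 p.γ_le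

lemma M_mul_le_ν : 8 * p.M ≤ p.ν := by
  rw [ν, le_div_iff₀ p.c_pos]
  nlinarith [p.c_le, p.M_pos]

lemma ν_pos : 0 < p.ν := div_pos p.M_pos p.c_pos

lemma r_pos : 0 < p.r := by
  have := p.c_pos; have := p.ε_pos; have := p.χ_pos; have := p.M_pos; have := p.P_pos
  unfold r; positivity

lemma g_pos : 0 < p.g := by
  have := p.c_pos; have := p.ε_pos; have := p.χ_pos; have := p.P_pos
  unfold g; positivity

lemma g_mul_r : p.g * p.r = p.φ := by
  have := p.χ_pos.ne'; have := p.P_pos.ne'; have := p.M_pos.ne'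
  rw [g, r, φ]
  field_simp

lemma M_mul_r_sq : p.M * p.r ^ 2 = p.c * p.φ := by
  have := p.χ_pos.ne'; have := p.P_pos.ne'; have := p.M_pos.ne'
  rw [r, φ]
  field_simp

lemma g_sq_div_ν : p.g ^ 2 / p.ν = p.φ := by
  have := p.χ_pos.ne'; have := p.P_pos.ne'; have := p.M_pos.ne'; have := p.c_pos.ne'
  rw [g, ν, φ]
  field_simp

lemma φ_pos : 0 < p.φ := p.g_mul_r ▸ mul_pos p.g_pos p.r_pos

lemma le_M_mul_χ_div : 24 ≤ p.M * p.χ / (p.c ^ 2 * p.γ) := by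
  have hc := p.c_pos
  have hγ := p.γ_pos
  calc (24 : ℝ) ≤ 1 * p.χ := by linarith [p.le_χ]
    _ ≤ p.M / p.γ * p.χ := by gcongr; exacts [p.χ_pos.le, p.one_le_M_div_γ]
    _ ≤ p.M / p.γ * p.χ / p.c ^ 2 := le_div_self
        (mul_nonneg (zero_le_one.trans p.one_le_M_div_γ) p.χ_pos.le) (by positivity)
        (pow_le_one₀ hc.le (by linarith [p.c_le]))
    _ = p.M * p.χ / (p.c ^ 2 * p.γ) := by field_simp

lemma M_mul_χ_div_le_τ : p.M * p.χ / (p.c ^ 2 * p.γ) ≤ p.τ := Nat.le_ceil _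

lemma τ_add_one_le : p.τ + 1 ≤ 2 * (p.M * p.χ / (p.c ^ 2 * p.γ)) := by
  have hlarge := p.le_M_mul_χ_div
  have hceil : p.τ < p.M * p.χ / (p.c ^ 2 * p.γ) + 1 := Nat.ceil_lt_add_one (by linarith)
  linarith

lemma τ_pos : 0 < p.τ := Nat.ceil_pos.2 (by linarith [p.le_M_mul_χ_div])

lemma τ_div_ν_le : p.τ / p.ν ≤ 2 * p.χ / (p.c * p.γ) := by
  have hc := p.c_pos
  have hM := p.M_pos
  have hγ := p.γ_pos
  rw [div_le_iff₀ p.ν_pos]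
  calc (p.τ : ℝ) ≤ 2 * (p.M * p.χ / (p.c ^ 2 * p.γ)) := by linarith [p.τ_add_one_le]
    _ = 2 * p.χ / (p.c * p.γ) * p.ν := by rw [ν]; field_simp

lemma κ_pos : 0 < p.κ := div_pos p.φ_pos (by positivity)

lemma κ_mul_eq : p.κ * (p.τ + 1) = p.φ := div_mul_cancel₀ _ (by positivity)

lemma κ_le : p.κ ≤ p.g ^ 2 / (2 * p.ν) := by
  have hτ : (1 : ℝ) ≤ p.τ := by exact_mod_cast p.τ_pos
  calc p.κ ≤ p.φ / 2 := div_le_div_of_nonneg_left p.φ_pos.le two_pos (by linarith)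
    _ = p.g ^ 2 / (2 * p.ν) := by rw [← p.g_sq_div_ν]; ring

lemma div_κ_le {Δ : ℝ} (hΔ : 0 ≤ Δ) : Δ / p.κ ≤ 2 * p.budget Δ * p.χ ^ 7 / p.c ^ 7 := by
  have hc := p.c_pos; have hM := p.M_pos; have hγ := p.γ_pos; have hφ := p.φ_pos
  have hχ := p.χ_pos; have hP := p.P_pos; have hε := p.ε_pos
  calc Δ / p.κ = Δ * (p.τ + 1) / p.φ := by rw [κ]; field_simp
    _ ≤ Δ * (2 * (p.M * p.χ / (p.c ^ 2 * p.γ))) / p.φ := by gcongr; exact p.τ_add_one_le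
    _ = 2 * p.budget Δ * p.χ ^ 7 / p.c ^ 7 := by rw [φ, budget]; field_simp

lemma S_sq : p.S ^ 2 = 100 * (p.χ / p.c) ^ 2 * (p.M / p.γ) * p.r ^ 2 := by
  rw [S, mul_pow, mul_pow, Real.sq_sqrt (zero_le_one.trans p.one_le_M_div_γ)]
  ring

lemma S_sq_eq_φ : p.S ^ 2 = 100 * p.χ ^ 2 / (p.c * p.γ) * p.φ := by
  have := p.c_pos.ne'; have := p.γ_pos.ne'
  calc p.S ^ 2 = 100 * (p.χ / p.c) ^ 2 / p.γ * (p.M * p.r ^ 2) := by rw [S_sq]; ring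
    _ = _ := by rw [M_mul_r_sq]; field_simp

lemma two_mul_r_le_S : 2 * p.r ≤ p.S := by
  have hχc : 1 ≤ p.χ / p.c := (one_le_div p.c_pos).2 (by linarith [p.c_le, p.le_χ])
  have hsqrt : 1 ≤ √(p.M / p.γ) := Real.one_le_sqrt.2 p.one_le_M_div_γ
  rw [S]
  exact mul_le_mul_of_nonneg_right (by nlinarith) p.r_pos.le

lemma initial_energy_le : 4 * p.g * p.r + p.M * p.r ^ 2 + p.φ ≤ 6 * p.φ := by
  have : p.c * p.φ ≤ 1 * p.φ := mul_le_mul_of_nonneg_right (by linarith [p.c_le]) p.φ_pos.le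
  linarith [p.M_mul_r_sq, p.g_mul_r]

lemma path_length_sq_le : 8 * (p.τ / p.ν) * (6 * p.φ) ≤ p.S ^ 2 := by
  have hc := p.c_pos; have hγ := p.γ_pos; have hφ := p.φ_pos; have hχ := p.χ_pos
  calc 8 * (p.τ / p.ν) * (6 * p.φ) ≤ 8 * (2 * p.χ / (p.c * p.γ)) * (6 * p.φ) := by
        gcongr 8 * ?_ * _; exact p.τ_div_ν_le
    _ = 96 * p.χ / (p.c * p.γ) * p.φ := by ring
    _ ≤ 100 * p.χ ^ 2 / (p.c * p.γ) * p.φ := by gcongr ?_ / _ * _; nlinarith [p.le_χ]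
    _ = p.S ^ 2 := p.S_sq_eq_φ.symm

lemma hessian_variation_le :
    4 * (p.τ / p.ν) * (64 * (p.ρ * p.S) ^ 2) * (8 * p.χ / (p.c * p.γ)) ≤ 1 := by
  have hc := p.c_pos; have hγ := p.γ_pos; have hM := p.M_pos; have hχ := p.χ_pos
  have hP := p.P_pos
  have hρε : p.ρ * p.ε = p.γ ^ 3 / p.M := by rw [γ_pow_three]; field_simp
  calc 4 * (p.τ / p.ν) * (64 * (p.ρ * p.S) ^ 2) * (8 * p.χ / (p.c * p.γ))
      ≤ 4 * (2 * p.χ / (p.c * p.γ)) * (64 * (p.ρ * p.S) ^ 2) * (8 * p.χ / (p.c * p.γ)) := by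
        gcongr 4 * ?_ * _ * _; exact p.τ_div_ν_le
    _ = 409600 * p.c ^ 2 * (p.ρ * p.ε) ^ 2 / (p.γ ^ 3 * p.M * p.χ ^ 2 * p.P ^ 2) := by
        rw [mul_pow p.ρ, S_sq_eq_φ, φ]; field_simp; ring
    _ = 409600 * p.c ^ 2 * (p.γ / p.M) ^ 3 / (p.χ ^ 2 * p.P ^ 2) := by rw [hρε]; field_simp
    _ ≤ 409600 * (1 / 100) ^ 2 * 1 ^ 3 / (24 ^ 2 * 1 ^ 2) := by
        gcongr
        exacts [p.c_le, (div_le_one hM).2 p.γ_le, p.le_χ, p.one_le_P]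
    _ ≤ 1 := by norm_num

lemma exp_le_one_add_pow : Real.exp (p.χ / (2 * p.c)) ≤ (1 + p.γ / (2 * p.ν)) ^ (2 * p.τ) := by
  have hγ := p.γ_pos; have hν := p.ν_pos; have hM := p.M_pos; have hc := p.c_pos
  have hle : p.γ / (2 * p.ν) ≤ 1 :=
    (div_le_one (by positivity)).2 (by linarith [p.γ_le, p.M_mul_le_ν])
  calc Real.exp (p.χ / (2 * p.c))
      = Real.exp (p.M * p.χ / (p.c ^ 2 * p.γ) * (p.γ / (2 * p.ν))) := by
        rw [ν]; congr 1; field_simp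
    _ ≤ Real.exp (p.τ * (p.γ / (2 * p.ν))) := by gcongr; exact p.M_mul_χ_div_le_τ
    _ = Real.exp (p.γ / (2 * p.ν) / 2) ^ (2 * p.τ) := by
        rw [← Real.exp_nat_mul]; push_cast; congr 1; ring
    _ ≤ (1 + p.γ / (2 * p.ν)) ^ (2 * p.τ) := by
        gcongr; exact exp_half_le_one_add (by positivity) hle

lemma budget_nonneg {Δ : ℝ} (hΔ : 0 ≤ Δ) : 0 ≤ p.budget Δ := by
  have := p.γ_pos
  unfold budget; positivity

lemma M_div_γ_le_of_pow_three_le {Δ : ℝ} (h : p.γ ^ 3 / (6 * p.ρ ^ 2) ≤ Δ) :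
    p.M / p.γ ≤ 6 * p.budget Δ := by
  have hM := p.M_pos; have hγ := p.γ_pos; have hε := p.ε_pos; have hρ := p.ρ_pos
  have hγ₆ : p.γ ^ 6 = p.M ^ 2 * p.ρ ^ 2 * p.ε ^ 2 := by
    rw [show p.γ ^ 6 = (p.γ ^ 3) ^ 2 by ring, γ_pow_three]; ring
  calc p.M / p.γ ≤ (p.M / p.γ) ^ 4 := le_self_pow₀ p.one_le_M_div_γ (by norm_num)
    _ = p.M ^ 4 * p.γ ^ 2 / p.γ ^ 6 := by field_simp
    _ = 6 * (p.M ^ 2 * 1 ^ 2 * (p.γ ^ 3 / (6 * p.ρ ^ 2)) / (p.γ * p.ε ^ 2)) := by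
        rw [hγ₆]; field_simp
    _ ≤ 6 * p.budget Δ := by unfold budget; gcongr; exact p.one_le_P

lemma M_div_γ_le_of_sq_le {Δ : ℝ} (h : p.ε ^ 2 / (4 * p.M) ≤ Δ) :
    p.M / p.γ ≤ 6 * p.budget Δ := by
  have hM := p.M_pos; have hγ := p.γ_pos; have hε := p.ε_pos
  calc p.M / p.γ ≤ 6 / 4 * (p.M / p.γ) := by linarith [p.one_le_M_div_γ]
    _ = 6 * (p.M ^ 2 * 1 ^ 2 * (p.ε ^ 2 / (4 * p.M)) / (p.γ * p.ε ^ 2)) := by field_simp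
    _ ≤ 6 * p.budget Δ := by unfold budget; gcongr; exact p.one_le_P

end Params

end Parameters

section Saddle

variable {m n : ℕ} {f : Vec m n → ℝ} {M ρ γ : ℝ}

/-- The Hessian of `f` at `x` has a direction of curvature less than `-γ`. -/
def HasCurvatureLT (f : Vec m n → ℝ) (γ : ℝ) (x : Vec m n) : Prop :=
  ∃ e : Vec m n, ‖e‖ = 1 ∧ ⟪e, hess f x e⟫ < -γ

lemma neg_le_lambdaMin {x : Vec m n} (hγ : 0 ≤ γ) (h : ¬ HasCurvatureLT f γ x) :
    -γ ≤ lambdaMin (hess f x) := by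
  rw [lambdaMin]
  rcases Set.eq_empty_or_nonempty
    {μ : ℝ | Module.End.HasEigenvalue (hess f x : Vec m n →ₗ[ℝ] Vec m n) μ} with hempty | hne
  · simpa [hempty] using hγ
  refine le_csInf hne fun μ hμ => not_lt.1 fun hlt => h ?_
  obtain ⟨v, hv⟩ := hμ.exists_hasEigenvector
  have hv₀ : ‖v‖ ≠ 0 := norm_ne_zero_iff.2 hv.2
  have happly : hess f x v = μ • v := hv.apply_eq_smul
  refine ⟨‖v‖⁻¹ • v, by rw [norm_smul, norm_inv, norm_norm, inv_mul_cancel₀ hv₀], ?_⟩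
  rw [map_smul, happly, real_inner_smul_left, real_inner_smul_right, real_inner_smul_right,
    real_inner_self_eq_norm_sq]
  calc ‖v‖⁻¹ * (‖v‖⁻¹ * (μ * ‖v‖ ^ 2)) = μ := by field_simp
    _ < -γ := hlt

lemma isSS2_of_not_hasCurvatureLT {ε : ℝ} {x : Vec m n} (hγ : 0 ≤ γ) (hgrad : ‖∇ f x‖ ≤ ε)
    (hcurv : ¬ HasCurvatureLT f γ x) : IsSS2 f ε γ x :=
  ⟨hgrad, neg_le_lambdaMin hγ hcurv⟩

lemma gap_nonneg (hb : BddBelow (Set.range f)) (x : Vec m n) : 0 ≤ gap f x :=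
  sub_nonneg.2 (ciInf_le hb x)

namespace BlockSmooth

lemma isOpen_setOf_hasCurvatureLT (hf : BlockSmooth f M ρ) :
    IsOpen {x | HasCurvatureLT f γ x} := by
  have hcont : Continuous (hess f) :=
    (LipschitzWith.of_dist_le' fun x y => by
      simpa only [dist_eq_norm] using hf.hessLip x y).continuous
  have hUnion : {x | HasCurvatureLT f γ x} =
      ⋃ e ∈ Metric.sphere (0 : Vec m n) 1, {x | ⟪e, hess f x e⟫ < -γ} := by
    ext x; simp [HasCurvatureLT]
  rw [hUnion]
  exact isOpen_biUnion fun e _ =>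
    isOpen_lt (continuous_const.inner (hcont.clm_apply continuous_const)) continuous_const

lemma pow_three_div_le_gap (hf : BlockSmooth f M ρ) (hb : BddBelow (Set.range f)) (hγ : 0 < γ)
    {x x₀ : Vec m n} (hx : HasCurvatureLT f γ x) (hle : f x ≤ f x₀) :
    γ ^ 3 / (6 * ρ ^ 2) ≤ gap f x₀ := by
  obtain ⟨e, he, hneg⟩ := hx
  obtain ⟨y, hy⟩ := exists_le_sub_of_inner_fderiv_gradient_le hf.diff hf.diff_grad hf.rho_pos
    hf.hessLip hγ he hneg.le
  rw [gap]
  linarith [ciInf_le hb y]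

lemma norm_grad_sq_div_le_gap (hf : BlockSmooth f M ρ) (hb : BddBelow (Set.range f))
    (x : Vec m n) : ‖∇ f x‖ ^ 2 / (4 * M) ≤ gap f x := by
  have hM := hf.pos
  obtain ⟨y, hy⟩ := exists_le_sub_norm_gradient_sq hf.diff (by positivity) hf.norm_grad_sub_le x
  rw [← mul_assoc, show (2 * 2 : ℝ) = 4 by norm_num] at hy
  rw [gap]
  linarith [ciInf_le hb y]

variable {p : Params}

lemma M_div_γ_le_of_hasCurvatureLT (hf : BlockSmooth f p.M p.ρ) (hb : BddBelow (Set.range f))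
    {x x₀ : Vec m n} (hx : HasCurvatureLT f p.γ x) (hle : f x ≤ f x₀) :
    p.M / p.γ ≤ 6 * p.budget (gap f x₀) :=
  p.M_div_γ_le_of_pow_three_le (hf.pow_three_div_le_gap hb p.γ_pos hx hle)

lemma M_div_γ_le_of_not_isSS2 (hf : BlockSmooth f p.M p.ρ) (hb : BddBelow (Set.range f))
    {x₀ : Vec m n} (hns : ¬ IsSS2 f p.ε p.γ x₀) : p.M / p.γ ≤ 6 * p.budget (gap f x₀) := by
  have hM := p.M_pos
  have hε := p.ε_pos
  rcases lt_or_ge p.ε ‖∇ f x₀‖ with hgrad | hgrad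
  · refine p.M_div_γ_le_of_sq_le (le_trans ?_ (hf.norm_grad_sq_div_le_gap hb x₀))
    gcongr
  · refine hf.M_div_γ_le_of_hasCurvatureLT hb (by_contra fun hcurv => hns ?_) le_rfl
    exact isSS2_of_not_hasCurvatureLT p.γ_pos.le hgrad hcurv

lemma norm_grad_le_of_norm_sub_le (hf : BlockSmooth f p.M p.ρ) (hb : BddBelow (Set.range f))
    {x : Vec m n} (hx : ‖appStep f p.ν x - x‖ ≤ p.g / p.ν) : ‖∇ f x‖ ≤ p.ε := by
  have hM := p.M_pos; have hν := p.ν_pos; have hε := p.ε_pos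
  have hχ := p.χ_pos; have hP := p.P_pos; have hc := p.c_pos
  calc ‖∇ f x‖ ≤ 4 * p.ν * ‖appStep f p.ν x - x‖ :=
        hf.norm_grad_le hb (by linarith [p.M_mul_le_ν]) x
    _ ≤ 4 * p.ν * (p.g / p.ν) := by gcongr
    _ = 4 * p.c ^ 2 / (p.χ ^ 3 * p.P) * p.ε := by rw [Params.g]; field_simp
    _ ≤ 4 * (1 / 100) ^ 2 / (24 ^ 3 * 1) * p.ε := by
        gcongr
        exacts [p.c_le, p.le_χ, p.one_le_P]
    _ ≤ p.ε := by linarith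

lemma pow_mul_sq_le_of_stuck (hf : BlockSmooth f p.M p.ρ) (hb : BddBelow (Set.range f))
    {z e x y : Vec m n} (hz : ‖appStep f p.ν z - z‖ ≤ p.g / p.ν) (he : ‖e‖ = 1)
    (hneg : ⟪e, hess f z e⟫ < -p.γ) (hx : ‖x‖ ≤ p.r) (hy : ‖y‖ ≤ p.r)
    (hx' : -p.φ < f ((appStep f p.ν)^[p.τ] (z + x)) - f z)
    (hy' : -p.φ < f ((appStep f p.ν)^[p.τ] (z + y)) - f z) {α : ℝ} (hα : y - x = α • e) :
    (1 + p.γ / (2 * p.ν)) ^ (2 * p.τ) * p.γ * α ^ 2 ≤ 256 * p.M * p.S ^ 2 := by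
  have hM := p.M_pos; have hγ := p.γ_pos; have hc := p.c_pos
  have hlocalized {ζ : Vec m n} (hζ : ‖ζ‖ ≤ p.r)
      (hstuck : -p.φ < f ((appStep f p.ν)^[p.τ] (z + ζ)) - f z) (t : ℕ) (ht : t ≤ p.τ) :
      ‖(appStep f p.ν)^[t] (z + ζ) - z‖ ≤ p.S :=
    hf.norm_iterate_sub_le hb (by linarith [p.M_mul_le_ν]) hz hζ hstuck p.initial_energy_le
      p.two_mul_r_le_S p.path_length_sq_le ht
  refine hf.growth_le hb p.M_mul_le_ν hγ p.γ_le he hneg.le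
    (by rw [add_sub_add_left_eq_sub, hα]) (hlocalized hx hx') (hlocalized hy hy')
    (R := 8 * p.χ / (p.c * p.γ)) ?_ ?_ p.hessian_variation_le
  · rw [← div_div]
    gcongr
    rw [le_div_iff₀ hc]
    linarith [p.c_le, p.le_χ]
  · linear_combination 4 * p.τ_div_ν_le

lemma lt_div_of_stuck (hf : BlockSmooth f p.M p.ρ) (hb : BddBelow (Set.range f)) {D : ℝ}
    (hD : 0 < D)
    (hgrow : 25600 * (p.M / p.γ) ^ 2 * p.χ ^ 2 * D ^ 2 < p.c ^ 2 * Real.exp (p.χ / (2 * p.c)))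
    {z e x y : Vec m n} (hz : ‖appStep f p.ν z - z‖ ≤ p.g / p.ν) (he : ‖e‖ = 1)
    (hneg : ⟪e, hess f z e⟫ < -p.γ) (hx : ‖x‖ ≤ p.r) (hy : ‖y‖ ≤ p.r)
    (hx' : -p.φ < f ((appStep f p.ν)^[p.τ] (z + x)) - f z)
    (hy' : -p.φ < f ((appStep f p.ν)^[p.τ] (z + y)) - f z) {α : ℝ} (hα : y - x = α • e) :
    α < p.r / D := by
  by_contra! hlong
  have hγ := p.γ_pos; have hc := p.c_pos; have hr := p.r_pos
  have hexp : Real.exp (p.χ / (2 * p.c)) * p.γ * (p.r / D) ^ 2 ≤ 256 * p.M * p.S ^ 2 := by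
    refine le_trans ?_ (hf.pow_mul_sq_le_of_stuck hb hz he hneg hx hy hx' hy' hα)
    have := p.ν_pos
    gcongr
    exact p.exp_le_one_add_pow
  refine hgrow.not_ge ?_
  calc p.c ^ 2 * Real.exp (p.χ / (2 * p.c))
      = Real.exp (p.χ / (2 * p.c)) * p.γ * (p.r / D) ^ 2 *
          (p.c ^ 2 * D ^ 2 / (p.γ * p.r ^ 2)) := by field_simp
    _ ≤ 256 * p.M * p.S ^ 2 * (p.c ^ 2 * D ^ 2 / (p.γ * p.r ^ 2)) := by gcongr
    _ = 25600 * (p.M / p.γ) ^ 2 * p.χ ^ 2 * D ^ 2 := by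
        rw [p.S_sq]; field_simp; ring

end BlockSmooth

end Saddle

section FailureProbability

variable {m n : ℕ} {f : Vec m n → ℝ}

/-- The pairs of a point `z` with `f z ≤ b` at which the method perturbs although `f` has curvature
less than `-γ` there, and of a perturbation after which it nevertheless stops and returns `z`. -/
def stuckSet (f : Vec m n → ℝ) (ν g φ γ b : ℝ) (τ : ℕ) : Set (Vec m n × Vec m n) :=
  {q | (‖appStep f ν q.1 - q.1‖ ≤ g / ν ∧ f q.1 ≤ b ∧ HasCurvatureLT f γ q.1) ∧
    -φ < f ((appStep f ν)^[τ] (q.1 + q.2)) - f q.1}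

lemma BlockSmooth.measurableSet_stuckSet {M ρ ν g φ γ b : ℝ} {τ : ℕ} (hf : BlockSmooth f M ρ)
    (hb : BddBelow (Set.range f)) (hν : 2 * M ≤ ν) :
    MeasurableSet (stuckSet f ν g φ γ b τ) := by
  have hA : Measurable (appStep f ν) := (hf.continuous_appStep hb hν).measurable
  have hfm : Measurable f := hf.diff.continuous.measurable
  have hshort : MeasurableSet {z | ‖appStep f ν z - z‖ ≤ g / ν ∧ f z ≤ b ∧ HasCurvatureLT f γ z} :=
    (measurableSet_le (hA.sub measurable_id).norm measurable_const).inter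
      ((measurableSet_le hfm measurable_const).inter hf.isOpen_setOf_hasCurvatureLT.measurableSet)
  exact (measurable_fst hshort).inter (measurableSet_lt measurable_const
    ((hfm.comp ((hA.iterate τ).comp (measurable_fst.add measurable_snd))).sub
      (hfm.comp measurable_fst)))

variable {p : Params} {x₀ : Vec m n} {K : ℕ} {Ω : Type*} [MeasurableSpace Ω] {μ : Measure Ω}
  {ξ : ℕ → Ω → Vec m n}

namespace BlockSmooth

lemma cond_closedBall_stuckSet_le (hf : BlockSmooth f p.M p.ρ) (hb : BddBelow (Set.range f))
    (hd : 0 < m + n) (hK : K ≠ 0) {b : ℝ}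
    (hgrow : ∀ z, f z ≤ b → HasCurvatureLT f p.γ z →
      25600 * (p.M / p.γ) ^ 2 * p.χ ^ 2 * ((m + n : ℕ) * K) ^ 2 <
        p.c ^ 2 * Real.exp (p.χ / (2 * p.c))) (z : Vec m n) :
    cond volume (Metric.closedBall 0 p.r)
      (Prod.mk z ⁻¹' stuckSet f p.ν p.g p.φ p.γ b p.τ) ≤ 3 / K := by
  by_cases hz : ‖appStep f p.ν z - z‖ ≤ p.g / p.ν ∧ f z ≤ b ∧ HasCurvatureLT f p.γ z
  · obtain ⟨hshort, hle, e, he, hneg⟩ := hz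
    refine cond_closedBall_le_of_thin volume hK p.r_pos he (measurable_prodMk_left
      (hf.measurableSet_stuckSet hb (by linarith [p.M_mul_le_ν, p.M_pos]))) ?_
    intro x hx y hy hxr hyr α hα
    rw [finrank_euclideanSpace, Fintype.card_sum, Fintype.card_fin, Fintype.card_fin]
    exact hf.lt_div_of_stuck hb (by positivity) (hgrow z hle ⟨e, he, hneg⟩) hshort he hneg hxr hyr
      hx.2 hy.2 hα
  · have hempty : Prod.mk z ⁻¹' stuckSet f p.ν p.g p.φ p.γ b p.τ = ∅ :=
      Set.eq_empty_of_forall_notMem fun x hx => hz hx.1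
    simp [hempty]

lemma measure_point_run_mem_stuckSet_le (hf : BlockSmooth f p.M p.ρ)
    (hb : BddBelow (Set.range f)) (hξ : ∀ t, Measurable (ξ t)) (hind : iIndepFun ξ μ) {t : ℕ}
    {b : ℝ} {δ : ENNReal}
    (hδ : ∀ z, μ.map (ξ t) (Prod.mk z ⁻¹' stuckSet f p.ν p.g p.φ p.γ b p.τ) ≤ δ) :
    μ {ω | ((run f p.ν p.g p.φ p.τ (ξ · ω) x₀ t).point, ξ t ω) ∈
      stuckSet f p.ν p.g p.φ p.γ b p.τ} ≤ δ := by
  have := hind.isProbabilityMeasure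
  have hν : 2 * p.M ≤ p.ν := by linarith [p.M_mul_le_ν, p.M_pos]
  have hrun : Measurable fun ζ => (run f p.ν p.g p.φ p.τ ζ x₀ t).point :=
    State.measurable_point.comp (measurable_run (hf.continuous_appStep hb hν).measurable
      hf.diff.continuous.measurable t)
  have hdep : DependsOn (fun ζ => (run f p.ν p.g p.φ p.τ ζ x₀ t).point) (Finset.range t) := by
    intro ζ ζ' h
    exact congrArg State.point (dependsOn_run t fun i hi => h i (by simpa using hi))
  exact measure_mem_le_of_indepFun (hrun.comp (measurable_pi_lambda _ hξ)) (hξ t)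
    (indepFun_of_dependsOn hξ hind (by simp) hrun hdep) (hf.measurableSet_stuckSet hb hν) hδ

lemma exists_returnsAt_or_mem_stuckSet (hf : BlockSmooth f p.M p.ρ) (hb : BddBelow (Set.range f))
    (ζ : ℕ → Vec m n) (x₀ : Vec m n) :
    ∃ tp x, ReturnsAt f p.ν p.g p.φ p.τ ζ x₀ (tp + p.τ) tp x ∧
      ‖appStep f p.ν x - x‖ ≤ p.g / p.ν ∧ tp * p.κ ≤ gap f x₀ ∧
      (HasCurvatureLT f p.γ x → ((run f p.ν p.g p.φ p.τ ζ x₀ tp).point, ζ tp) ∈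
        stuckSet f p.ν p.g p.φ p.γ (f x₀) p.τ) := by
  obtain ⟨tp, x, hfree, hshort, hstuck⟩ := exists_freeAt_stuck (ξ := ζ) (x₀ := x₀) hb
    (appStep_le hf.diff.continuous hb p.ν_pos) p.ν_pos p.g_pos.le p.κ_pos p.τ_pos p.κ_le
    p.κ_mul_eq.le
  have hdecrease := hfree.decrease
  have hκ : 0 ≤ tp * p.κ := mul_nonneg tp.cast_nonneg p.κ_pos.le
  obtain ⟨last, hrun, -⟩ := hfree.run_eq
  have hle : f x ≤ f x₀ := by linarith
  refine ⟨tp, x, hfree.returnsAt p.τ_pos hshort hstuck, hshort, ?_, fun hcurv => ?_⟩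
  · rw [gap]
    linarith [ciInf_le hb x]
  · rw [hrun]
    exact ⟨⟨hshort, hle, hcurv⟩, hstuck⟩

lemma measure_not_returnsAt_le (hf : BlockSmooth f p.M p.ρ) (hb : BddBelow (Set.range f))
    (hd : 0 < m + n) (hK : K ≠ 0)
    (hgrow : ∀ z, f z ≤ f x₀ → HasCurvatureLT f p.γ z →
      25600 * (p.M / p.γ) ^ 2 * p.χ ^ 2 * ((m + n : ℕ) * K) ^ 2 <
        p.c ^ 2 * Real.exp (p.χ / (2 * p.c)))
    (hξ : ∀ t, Measurable (ξ t)) (hind : iIndepFun ξ μ)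
    (hunif : ∀ t, pdf.IsUniform (ξ t) (Metric.closedBall 0 p.r) μ volume) :
    μ {ω | ¬ ∃ tp x, ReturnsAt f p.ν p.g p.φ p.τ (ξ · ω) x₀ (tp + p.τ) tp x ∧
      IsSS2 f p.ε p.γ x ∧ tp * p.κ ≤ gap f x₀} ≤ (⌊gap f x₀ / p.κ⌋₊ + 1 : ℕ) * (3 / K) := by
  calc _ ≤ μ (⋃ t ∈ Finset.range (⌊gap f x₀ / p.κ⌋₊ + 1),
        {ω | ((run f p.ν p.g p.φ p.τ (ξ · ω) x₀ t).point, ξ t ω) ∈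
          stuckSet f p.ν p.g p.φ p.γ (f x₀) p.τ}) := by
        refine measure_mono fun ω hω => ?_
        obtain ⟨tp, x, hret, hshort, htp, hstuck⟩ :=
          hf.exists_returnsAt_or_mem_stuckSet hb (ξ · ω) x₀
        have hcurv : HasCurvatureLT f p.γ x := not_not.1 fun h => hω ⟨tp, x, hret,
          isSS2_of_not_hasCurvatureLT p.γ_pos.le (hf.norm_grad_le_of_norm_sub_le hb hshort) h, htp⟩
        have htp' : tp < ⌊gap f x₀ / p.κ⌋₊ + 1 :=
          Nat.lt_succ_of_le (Nat.le_floor ((le_div_iff₀ p.κ_pos).2 htp))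
        exact Set.mem_biUnion (Finset.mem_coe.2 (Finset.mem_range.2 htp')) (hstuck hcurv)
    _ ≤ ∑ _t ∈ Finset.range (⌊gap f x₀ / p.κ⌋₊ + 1), 3 / (K : ENNReal) := by
        refine (measure_biUnion_finset_le _ _).trans (Finset.sum_le_sum fun t _ => ?_)
        refine hf.measure_point_run_mem_stuckSet_le hb hξ hind fun z => ?_
        rw [(hunif t : μ.map (ξ t) = _)]
        exact hf.cond_closedBall_stuckSet_le hb hd hK hgrow z
    _ = (⌊gap f x₀ / p.κ⌋₊ + 1 : ℕ) * (3 / K) := by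
        rw [Finset.sum_const, Finset.card_range, nsmul_eq_mul]

end BlockSmooth

end FailureProbability

section Complexity

namespace Params

variable (p : Params) {d : ℕ} {δ Δ : ℝ}

/-- The number of disjoint translates of the stuck set that makes a union bound over the
`⌊Δ / κ⌋ + 1` possible perturbation times cost at most `δ`. -/
def translates (δ Δ : ℝ) : ℕ := ⌈3 * (⌊Δ / p.κ⌋₊ + 1) / δ⌉₊

/-- The argument `𝒫² d L_max^{5/3} Δ / (c⁵ ρ^{1/3} ε^{7/3} δ)` of the logarithm `ℓ`. -/
def logArg (d : ℕ) (δ Δ : ℝ) : ℝ := p.budget Δ * d / (p.c ^ 5 * δ)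

lemma translates_pos (hδ : 0 < δ) : 0 < p.translates δ Δ := Nat.ceil_pos.2 (by positivity)

lemma translates_le (hδ : 0 < δ) (hδ₁ : δ ≤ 1) (hΔ : 0 ≤ Δ) (hB : 1 ≤ 6 * p.budget Δ) :
    p.translates δ Δ ≤ 12 * p.budget Δ * p.χ ^ 7 / (p.c ^ 7 * δ) := by
  have hc := p.c_pos
  have hfloor : (⌊Δ / p.κ⌋₊ : ℝ) + 1 ≤ 3 * p.budget Δ * p.χ ^ 7 / p.c ^ 7 := by
    have hone : 1 ≤ p.budget Δ * p.χ ^ 7 / p.c ^ 7 := by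
      rw [one_le_div (by positivity)]
      calc p.c ^ 7 ≤ 1 := pow_le_one₀ hc.le (by linarith [p.c_le])
        _ ≤ p.budget Δ * 24 ^ 7 := by linarith
        _ ≤ p.budget Δ * p.χ ^ 7 := by gcongr; exacts [p.budget_nonneg hΔ, p.le_χ]
    calc (⌊Δ / p.κ⌋₊ : ℝ) + 1
        ≤ 2 * p.budget Δ * p.χ ^ 7 / p.c ^ 7 + p.budget Δ * p.χ ^ 7 / p.c ^ 7 := by
          gcongr
          exact (Nat.floor_le (div_nonneg hΔ p.κ_pos.le)).trans (p.div_κ_le hΔ)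
      _ = 3 * p.budget Δ * p.χ ^ 7 / p.c ^ 7 := by ring
  have hone : 1 ≤ (⌊Δ / p.κ⌋₊ + 1) / δ :=
    (one_le_div hδ).2 (hδ₁.trans (le_add_of_nonneg_left (Nat.cast_nonneg _)))
  calc (p.translates δ Δ : ℝ) ≤ 3 * (⌊Δ / p.κ⌋₊ + 1) / δ + 1 :=
        (Nat.ceil_lt_add_one (by positivity)).le
    _ ≤ 4 * ((⌊Δ / p.κ⌋₊ + 1) / δ) := by linear_combination hone
    _ ≤ 4 * (3 * p.budget Δ * p.χ ^ 7 / p.c ^ 7 / δ) := by gcongr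
    _ = 12 * p.budget Δ * p.χ ^ 7 / (p.c ^ 7 * δ) := by ring

lemma budget_div_le_logArg (hd : 0 < d) (hδ : 0 < δ) (hδ₁ : δ ≤ 1) (hΔ : 0 ≤ Δ) :
    p.budget Δ / p.c ^ 5 ≤ p.logArg d δ Δ := by
  have hc := p.c_pos
  have hB := p.budget_nonneg hΔ
  have hd₁ : (1 : ℝ) ≤ d := by exact_mod_cast hd
  calc p.budget Δ / p.c ^ 5 = p.budget Δ * 1 / (p.c ^ 5 * 1) := by ring
    _ ≤ p.logArg d δ Δ := by unfold logArg; gcongr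

lemma budget_le_logArg (hd : 0 < d) (hδ : 0 < δ) (hδ₁ : δ ≤ 1) (hΔ : 0 ≤ Δ) :
    p.budget Δ ≤ p.logArg d δ Δ :=
  (le_div_self (p.budget_nonneg hΔ) (pow_pos p.c_pos 5)
    (pow_le_one₀ p.c_pos.le (by linarith [p.c_le]))).trans (p.budget_div_le_logArg hd hδ hδ₁ hΔ)

lemma lt_exp_of_logArg_le (hd : 0 < d) (hδ : 0 < δ) (hδ₁ : δ ≤ 1) (hΔ : 0 ≤ Δ)
    (hB : p.M / p.γ ≤ 6 * p.budget Δ) (hG : p.logArg d δ Δ ≤ Real.exp (p.χ / 6)) :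
    25600 * (p.M / p.γ) ^ 2 * p.χ ^ 2 * (d * p.translates δ Δ) ^ 2 <
      p.c ^ 2 * Real.exp (p.χ / (2 * p.c)) := by
  have hc := p.c_pos
  have hχ := p.χ_pos
  have hMγ := p.one_le_M_div_γ
  have hBG := p.budget_le_logArg hd hδ hδ₁ hΔ
  have hG₀ := (p.budget_nonneg hΔ).trans hBG
  have hdK : d * (p.translates δ Δ : ℝ) ≤ 12 * p.χ ^ 7 * p.logArg d δ Δ / p.c ^ 2 := by
    calc d * (p.translates δ Δ : ℝ)
        ≤ d * (12 * p.budget Δ * p.χ ^ 7 / (p.c ^ 7 * δ)) := by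
          gcongr; exact p.translates_le hδ hδ₁ hΔ (hMγ.trans hB)
      _ = 12 * p.χ ^ 7 * p.logArg d δ Δ / p.c ^ 2 := by rw [logArg]; field_simp
  calc 25600 * (p.M / p.γ) ^ 2 * p.χ ^ 2 * (d * p.translates δ Δ) ^ 2
      ≤ 25600 * (6 * p.logArg d δ Δ) ^ 2 * p.χ ^ 2 *
          (12 * p.χ ^ 7 * p.logArg d δ Δ / p.c ^ 2) ^ 2 := by
        gcongr; linarith
    _ = 132710400 * (p.χ ^ 16 * p.logArg d δ Δ ^ 4 / p.c ^ 4) := by ring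
    _ ≤ p.χ ^ 6 * (p.χ ^ 16 * p.logArg d δ Δ ^ 4 / p.c ^ 4) := by
        gcongr
        calc (132710400 : ℝ) ≤ 24 ^ 6 := by norm_num
          _ ≤ p.χ ^ 6 := by gcongr; exact p.le_χ
    _ = p.c ^ 2 * (p.χ ^ 22 * p.logArg d δ Δ ^ 4 * p.c⁻¹ ^ 6) := by field_simp
    _ < p.c ^ 2 * Real.exp (p.χ / (2 * p.c)) := by
        gcongr; exact pow_mul_pow_mul_inv_pow_lt_exp hc p.c_le p.le_χ hG₀ hG

lemma mul_div_translates_le (hδ : 0 < δ) :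
    (⌊Δ / p.κ⌋₊ + 1 : ℕ) * (3 / p.translates δ Δ : ENNReal) ≤ ENNReal.ofReal δ := by
  have hK : (0 : ℝ) < p.translates δ Δ := by exact_mod_cast p.translates_pos hδ
  calc (⌊Δ / p.κ⌋₊ + 1 : ℕ) * (3 / p.translates δ Δ : ENNReal)
      = ENNReal.ofReal ((⌊Δ / p.κ⌋₊ + 1 : ℕ) * (3 / p.translates δ Δ)) := by
        rw [ENNReal.ofReal_mul (by positivity), ENNReal.ofReal_div_of_pos hK]
        simp only [ENNReal.ofReal_natCast, ENNReal.ofReal_ofNat]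
    _ ≤ ENNReal.ofReal δ := by
        refine ENNReal.ofReal_le_ofReal ?_
        have hceil : 3 * (⌊Δ / p.κ⌋₊ + 1) / δ ≤ p.translates δ Δ := Nat.le_ceil _
        rw [div_le_iff₀ hδ] at hceil
        rw [mul_div_assoc', div_le_iff₀ hK]
        push_cast
        linarith

lemma four_le_log (hd : 0 < d) (hδ : 0 < δ) (hδ₁ : δ ≤ 1) (hΔ : 0 ≤ Δ)
    (hB : 1 ≤ 6 * p.budget Δ) : 4 ≤ Real.log (p.logArg d δ Δ) := by
  have hc := p.c_pos
  have hexp : Real.exp 4 ≤ 3 ^ 4 := by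
    calc Real.exp 4 = Real.exp 1 ^ 4 := by rw [← Real.exp_nat_mul]; norm_num
      _ ≤ 3 ^ 4 := by gcongr; linarith [Real.exp_one_lt_d9]
  have hle : Real.exp 4 ≤ p.logArg d δ Δ := by
    refine le_trans ?_ (p.budget_div_le_logArg hd hδ hδ₁ hΔ)
    rw [le_div_iff₀ (by positivity)]
    calc Real.exp 4 * p.c ^ 5 ≤ 3 ^ 4 * (1 / 100) ^ 5 := by gcongr; exact p.c_le
      _ ≤ p.budget Δ := by norm_num; linarith
  exact (Real.le_log_iff_exp_le ((Real.exp_pos 4).trans_le hle)).2 hle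

lemma index_le {ℓ k : ℝ} (hΔ : 0 ≤ Δ) (hχ : p.χ = 6 * max ℓ 4) (hk : k * p.κ ≤ Δ) :
    k ≤ 24 ^ 8 / p.c ^ 7 * p.budget Δ * max ℓ 1 ^ 7 := by
  have hc := p.c_pos
  have hB := p.budget_nonneg hΔ
  have hχ₀ := p.χ_pos
  have hmax : max ℓ 4 ≤ 4 * max ℓ 1 :=
    max_le (by linarith [le_max_left ℓ 1, le_max_right ℓ 1]) (by linarith [le_max_right ℓ 1])
  calc k ≤ Δ / p.κ := (le_div_iff₀ p.κ_pos).2 hk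
    _ ≤ 2 * p.budget Δ * p.χ ^ 7 / p.c ^ 7 := p.div_κ_le hΔ
    _ ≤ 2 * p.budget Δ * (24 * max ℓ 1) ^ 7 / p.c ^ 7 := by gcongr; linarith
    _ = 2 * 24 ^ 7 / p.c ^ 7 * p.budget Δ * max ℓ 1 ^ 7 := by ring
    _ ≤ 24 ^ 8 / p.c ^ 7 * p.budget Δ * max ℓ 1 ^ 7 := by gcongr; norm_num

lemma index_add_τ_le {ℓ k : ℝ} (hΔ : 0 ≤ Δ) (hℓ : 4 ≤ ℓ) (hχ : p.χ = 6 * max ℓ 4)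
    (hB : p.M / p.γ ≤ 6 * p.budget Δ) (hk : k * p.κ ≤ Δ) :
    k + p.τ ≤ 24 ^ 8 / p.c ^ 7 * p.budget Δ * ℓ ^ 7 := by
  have hc := p.c_pos
  have hγ := p.γ_pos
  have hB₀ := p.budget_nonneg hΔ
  rw [max_eq_left hℓ] at hχ
  have hk' : k ≤ 2 * p.budget Δ * (6 * ℓ) ^ 7 / p.c ^ 7 :=
    hχ ▸ ((le_div_iff₀ p.κ_pos).2 hk).trans (p.div_κ_le hΔ)
  have hτ : p.τ ≤ 72 * p.budget Δ * ℓ ^ 7 / p.c ^ 7 := by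
    calc (p.τ : ℝ) ≤ 2 * (p.M * p.χ / (p.c ^ 2 * p.γ)) := by linarith [p.τ_add_one_le]
      _ = 12 * (p.M / p.γ) * ℓ / p.c ^ 2 := by rw [hχ]; ring
      _ ≤ 12 * (6 * p.budget Δ) * ℓ ^ 7 / p.c ^ 7 := by
        gcongr ?_ / ?_
        · have : ℓ ≤ ℓ ^ 7 := le_self_pow₀ (by linarith) (by norm_num)
          gcongr
        · exact pow_le_pow_of_le_one hc.le (by linarith [p.c_le]) (by norm_num)
      _ = 72 * p.budget Δ * ℓ ^ 7 / p.c ^ 7 := by ring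
  calc k + p.τ ≤ 2 * p.budget Δ * (6 * ℓ) ^ 7 / p.c ^ 7 + 72 * p.budget Δ * ℓ ^ 7 / p.c ^ 7 :=
        add_le_add hk' hτ
    _ = (2 * 6 ^ 7 + 72) / p.c ^ 7 * p.budget Δ * ℓ ^ 7 := by ring
    _ ≤ 24 ^ 8 / p.c ^ 7 * p.budget Δ * ℓ ^ 7 := by gcongr; norm_num

end Params

lemma BlockSmooth.measure_not_returnsAt_le_ofReal {m n : ℕ} {f : Vec m n → ℝ} {p : Params}
    {x₀ : Vec m n} {Ω : Type*} [MeasurableSpace Ω] {μ : Measure Ω} {ξ : ℕ → Ω → Vec m n} {δ : ℝ}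
    (hf : BlockSmooth f p.M p.ρ) (hb : BddBelow (Set.range f)) (hd : 0 < m + n)
    (hδ : 0 < δ) (hδ₁ : δ ≤ 1) (hG : p.logArg (m + n) δ (gap f x₀) ≤ Real.exp (p.χ / 6))
    (hξ : ∀ t, Measurable (ξ t)) (hind : iIndepFun ξ μ)
    (hunif : ∀ t, pdf.IsUniform (ξ t) (Metric.closedBall 0 p.r) μ volume) :
    μ {ω | ¬ ∃ tp x, ReturnsAt f p.ν p.g p.φ p.τ (ξ · ω) x₀ (tp + p.τ) tp x ∧
      IsSS2 f p.ε p.γ x ∧ tp * p.κ ≤ gap f x₀} ≤ ENNReal.ofReal δ :=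
  (hf.measure_not_returnsAt_le hb hd (p.translates_pos hδ).ne'
    (fun _ hle hcurv => p.lt_exp_of_logArg_le hd hδ hδ₁ (gap_nonneg hb x₀)
      (hf.M_div_γ_le_of_hasCurvatureLT hb hcurv hle) hG) hξ hind hunif).trans
    (p.mul_div_translates_le hδ)

lemma one_le_calP {d : ℕ} {L M : ℝ} (hd : 0 < d) (hL : 0 ≤ L) (hM : 0 ≤ M) : 1 ≤ calP d L M := by
  have hd₁ : (1 : ℝ) ≤ d := by exact_mod_cast hd
  have hlog : 0 ≤ Real.log (2 * d) := Real.log_nonneg (by linarith)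
  exact le_add_of_nonneg_right (by positivity)

lemma rpow_div_rpow_eq {M ρ ε : ℝ} (hM : 0 < M) (hρ : 0 < ρ) (hε : 0 < ε) :
    M ^ (5 / 3 : ℝ) / (ρ ^ (1 / 3 : ℝ) * ε ^ (7 / 3 : ℝ)) = M ^ 2 / (gam M ρ ε * ε ^ 2) := by
  have hM₂ : M ^ 2 = M ^ (5 / 3 : ℝ) * M ^ (1 / 3 : ℝ) := by
    rw [← Real.rpow_add hM, ← Real.rpow_natCast]; norm_num
  have hε₇ : ε ^ (7 / 3 : ℝ) = ε ^ (1 / 3 : ℝ) * ε ^ 2 := by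
    rw [← Real.rpow_natCast ε 2, ← Real.rpow_add hε]; norm_num
  rw [gam, Real.mul_rpow (by positivity) hε.le, Real.mul_rpow hM.le hρ.le, hM₂, hε₇,
    div_eq_div_iff (by positivity) (by positivity)]
  ring

lemma rate_eq {d : ℕ} {L M ρ ε Δ : ℝ} (hM : 0 < M) (hρ : 0 < ρ) (hε : 0 < ε) :
    rate d L M ρ ε Δ = M ^ 2 * calP d L M ^ 2 * Δ / (gam M ρ ε * ε ^ 2) := by
  calc rate d L M ρ ε Δ
      = M ^ (5 / 3 : ℝ) / (ρ ^ (1 / 3 : ℝ) * ε ^ (7 / 3 : ℝ)) * (calP d L M ^ 2 * Δ) := by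
        rw [rate]; ring
    _ = M ^ 2 * calP d L M ^ 2 * Δ / (gam M ρ ε * ε ^ 2) := by
        rw [rpow_div_rpow_eq hM hρ hε]; ring

lemma logTerm_eq (d : ℕ) (L M ρ ε δ Δ c : ℝ) :
    logTerm d L M ρ ε δ Δ c = Real.log (rate d L M ρ ε Δ * d / (c ^ 5 * δ)) := by
  rw [logTerm, rate, div_mul_eq_mul_div, div_div]
  congr 2 <;> ring

/-- The parameters of the method for `d`, `L`, `δ`, `Δ`: `χ` and `P` are `chi` and `calP`. -/
def Params.ofProblem {M ρ ε c : ℝ} (hM : 0 < M) (hρ : 0 < ρ) (hε : 0 < ε) (hεM : ε ≤ M ^ 2 / ρ)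
    (hc : 0 < c) (hc' : c ≤ 1 / 100) {d : ℕ} (hd : 0 < d) {L : ℝ} (hL : 0 ≤ L) (δ Δ : ℝ) :
    Params where
  M := M
  ρ := ρ
  ε := ε
  c := c
  χ := chi d L M ρ ε δ Δ c
  P := calP d L M
  M_pos := hM
  ρ_pos := hρ
  ε_pos := hε
  ε_le := hεM
  c_pos := hc
  c_le := hc'
  le_χ := by rw [chi]; linarith [le_max_right (logTerm d L M ρ ε δ Δ c) 4]
  one_le_P := one_le_calP hd hL hM.le

lemma le_exp_max_log {G : ℝ} (hG : 0 ≤ G) (a : ℝ) : G ≤ Real.exp (max (Real.log G) a) := by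
  rcases hG.eq_or_lt with rfl | hpos
  · positivity
  · exact (Real.log_le_iff_le_exp hpos).1 (le_max_left _ _)

end Complexity

end

end PAPP

theorem corollary1_general {m n : ℕ} (hd : 0 < m + n) {f : PAPP.Vec m n → ℝ} {M ρ : ℝ}
    (hf : PAPP.BlockSmooth f M ρ) (hb : BddBelow (Set.range f)) {L : ℝ} (hL : 0 ≤ L)
    (x₀ : PAPP.Vec m n) {Δ : ℝ} (hΔ : Δ = PAPP.gap f x₀) {δ : ℝ} (hδ : 0 < δ) (hδ₁ : δ ≤ 1)
    {ε : ℝ} (hε : 0 < ε) (hεM : ε ≤ M ^ 2 / ρ) {c : ℝ} (hc : 0 < c) (hc' : c ≤ 1 / 100)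
    {Ω : Type*} [MeasurableSpace Ω] {P : Measure Ω} {ξ : ℕ → Ω → PAPP.Vec m n}
    (hξ : ∀ t, Measurable (ξ t)) (hind : iIndepFun ξ P)
    (hunif : ∀ t, pdf.IsUniform (ξ t)
      (Metric.closedBall 0 (PAPP.radius (m + n) L M ρ ε δ Δ c)) P volume) :
    P {ω | ¬ ∃ (T tp : ℕ) (x : PAPP.Vec m n),
        PAPP.ReturnsAt f (PAPP.nu M c) (PAPP.gth (m + n) L M ρ ε δ Δ c)
          (PAPP.fth (m + n) L M ρ ε δ Δ c) (PAPP.tth (m + n) L M ρ ε δ Δ c)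
          (fun t => ξ t ω) x₀ T tp x ∧
        PAPP.IsSS2 f ε (PAPP.gam M ρ ε) x ∧
        T = tp + PAPP.tth (m + n) L M ρ ε δ Δ c ∧
        (tp : ℝ) ≤ 24 ^ 8 / c ^ 7 * PAPP.rate (m + n) L M ρ ε Δ *
          max (PAPP.logTerm (m + n) L M ρ ε δ Δ c) 1 ^ 7 ∧
        (¬ PAPP.IsSS2 f ε (PAPP.gam M ρ ε) x₀ →
          (T : ℝ) ≤ 24 ^ 8 / c ^ 7 * PAPP.rate (m + n) L M ρ ε Δ *
            PAPP.logTerm (m + n) L M ρ ε δ Δ c ^ 7)}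
      ≤ ENNReal.ofReal δ := by
  subst hΔ
  have hΔ₀ := PAPP.gap_nonneg hb x₀
  let p := PAPP.Params.ofProblem hf.pos hf.rho_pos hε hεM hc hc' hd hL δ (PAPP.gap f x₀)
  have hrate : PAPP.rate (m + n) L M ρ ε (PAPP.gap f x₀) = p.budget (PAPP.gap f x₀) :=
    PAPP.rate_eq hf.pos hf.rho_pos hε
  have hlog : PAPP.logTerm (m + n) L M ρ ε δ (PAPP.gap f x₀) c =
      Real.log (p.logArg (m + n) δ (PAPP.gap f x₀)) := by
    rw [PAPP.logTerm_eq, hrate]; rfl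
  have hχ : p.χ = 6 * max (Real.log (p.logArg (m + n) δ (PAPP.gap f x₀))) 4 :=
    congrArg (6 * max · 4) hlog
  have hG : p.logArg (m + n) δ (PAPP.gap f x₀) ≤ Real.exp (p.χ / 6) := by
    rw [hχ, mul_div_cancel_left₀ _ (by norm_num)]
    exact PAPP.le_exp_max_log
      ((p.budget_nonneg hΔ₀).trans (p.budget_le_logArg hd hδ hδ₁ hΔ₀)) 4
  refine (measure_mono fun ω hω => ?_).trans
    (hf.measure_not_returnsAt_le_ofReal (p := p) hb hd hδ hδ₁ hG hξ hind hunif)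
  rintro ⟨tp, x, hret, hss, htp⟩
  rw [hrate, hlog] at hω
  refine hω ⟨tp + p.τ, tp, x, hret, hss, rfl, p.index_le hΔ₀ hχ htp, fun hns => ?_⟩
  have hB := hf.M_div_γ_le_of_not_isSS2 (p := p) hb hns
  push_cast
  exact p.index_add_τ_le hΔ₀ (p.four_le_log hd hδ hδ₁ hΔ₀ (p.one_le_M_div_γ.trans hB)) hχ hB htp

theorem corollary1 :
    ∃ cmax : ℝ, 0 < cmax ∧ ∃ C : ℝ, 0 < C ∧
      ∀ (m n : ℕ), 0 < m → 0 < n →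
      ∀ (f : PAPP.Vec m n → ℝ) (L L₁ L₂ K₁ K₂ ρ : ℝ),
        PAPP.Assumption f L L₁ L₂ K₁ K₂ ρ → 0 < ρ →
      ∀ M : ℝ, M = PAPP.Lmax L₁ L₂ K₁ K₂ → M ≤ L →
        BddBelow (Set.range f) →
      ∀ (x₀ : PAPP.Vec m n) (Δ : ℝ), Δ = PAPP.gap f x₀ →
      ∀ δ : ℝ, 0 < δ → δ ≤ 1 →
      ∀ ε : ℝ, 0 < ε → ε ≤ M ^ 2 / ρ →
      ∀ c : ℝ, 0 < c → c ≤ cmax →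
      ∀ (Ω : Type*) [MeasurableSpace Ω] (P : Measure Ω) [IsProbabilityMeasure P]
        (ξ : ℕ → Ω → PAPP.Vec m n),
        (∀ t, Measurable (ξ t)) →
        iIndepFun ξ P →
        (∀ t, pdf.IsUniform (ξ t)
          (Metric.closedBall 0 (PAPP.radius (m + n) L M ρ ε δ Δ c)) P volume) →
        -- the complement of the good event has probability at most `δ`
        P {ω | ¬ ∃ (T tp : ℕ) (x : PAPP.Vec m n),
            PAPP.ReturnsAt f (PAPP.nu M c) (PAPP.gth (m + n) L M ρ ε δ Δ c)
              (PAPP.fth (m + n) L M ρ ε δ Δ c) (PAPP.tth (m + n) L M ρ ε δ Δ c)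
              (fun t => ξ t ω) x₀ T tp x ∧
            PAPP.IsSS2 f ε (PAPP.gam M ρ ε) x ∧
            T = tp + PAPP.tth (m + n) L M ρ ε δ Δ c ∧
            (tp : ℝ) ≤ C / c ^ 7 * PAPP.rate (m + n) L M ρ ε Δ *
              max (PAPP.logTerm (m + n) L M ρ ε δ Δ c) 1 ^ 7 ∧
            (¬ PAPP.IsSS2 f ε (PAPP.gam M ρ ε) x₀ →
              (T : ℝ) ≤ C / c ^ 7 * PAPP.rate (m + n) L M ρ ε Δ *
                PAPP.logTerm (m + n) L M ρ ε δ Δ c ^ 7)}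
          ≤ ENNReal.ofReal δ := by
  refine ⟨1 / 100, by norm_num, 24 ^ 8, by norm_num, ?_⟩
  rintro m n hm - f L L₁ L₂ K₁ K₂ ρ h hρ _ rfl hL hb x₀ Δ hΔ δ hδ hδ₁ ε hε hεM c hc hc' Ω _ P _ ξ
    hξ hind hunif
  have hM : 0 < PAPP.Lmax L₁ L₂ K₁ K₂ :=
    h.lmax_pos hm fun h₀ => hε.not_ge (by simpa [h₀] using hεM)
  exact corollary1_general (by lia) (h.blockSmooth hρ hM) hb (hM.le.trans hL) x₀ hΔ hδ hδ₁ hε hεM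
    hc hc' hξ hind hunif
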